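/- Let $R$ be a commutative artinian ring, $\Lambda$ an Artin $R$-algebra, and $\operatorname{mod}\Lambda$ the category of right $\Lambda$-modules of finite length. Let $d\ge 1$ and let $\mathcal M\subseteq\operatorname{mod}\Lambda$ be a $d$-cluster-tilting subcategory, that is, a functorially finite full subcategory with $$\mathcal M=\{X\in\operatorname{mod}\Lambda\mid \operatorname{Ext}^k_\Lambda(X,\mathcal M)=0,\ 1\le k\le d-1\}=\{Y\in\operatorname{mod}\Lambda\mid \operatorname{Ext}^k_\Lambda(\mathcal M,Y)=0,\ 1\le k\le d-1\}.$$ A complex $K^0\to K^1\to\cdots\to K^d\to K^{d+1}$ with terms in $\mathcal M$ is \emph{left $d$-exact} in $\mathcal M$ if $0\to\operatorname{Hom}_\Lambda(X,K^0)\to\cdots\to\operatorname{Hom}_\Lambda(X,K^{d+1})$ is exact for all $X\in\mathcal M$, \emph{right $d$-exact} in $\mathcal M$ if $0\to\operatorname{Hom}_\Lambda(K^{d+1},Y)\to\cdots\to\operatorname{Hom}_\Lambda(K^0,Y)$ is exact for all $Y\in\mathcal M$, and \emph{$d$-exact} if it is both. A morphism $u$ from a complex $M^0\xrightarrow{f^0}\cdots\xrightarrow{f^{d-1}}M^d$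 to a complex $N^0\xrightarrow{g^0}\cdots\xrightarrow{g^{d-1}}N^d$ is a \emph{$d$-pushout diagram} in $\mathcal M$ if its mapping cone $M^0\to M^1\oplus N^0\to\cdots\to M^d\oplus N^{d-1}\to N^d$, with differentials $\begin{bmatrix}-f^0\\u^0\end{bmatrix}$, $\begin{bmatrix}-f^i&0\\u^i&g^{i-1}\end{bmatrix}$ $(1\le i\le d-1)$ and $\begin{bmatrix}u^d&g^{d-1}\end{bmatrix}$, is a right $d$-exact sequence in $\mathcal M$. For $X\in\mathcal M$, a morphism $g\colon M\to N$ in $\mathcal M$ is \emph{right $X$-determined} in $\mathcal M$ if every morphism $h\colon V\to N$ in $\mathcal M$ with $\operatorname{Im}\operatorname{Hom}_\Lambda(X,h)\subseteq\operatorname{Im}\operatorname{Hom}_\Lambda(X,g)$ factors through $g$. \textbf{Proposition.} Let $X\in\mathcal M$ and let $$\delta\colon\quad 0\to L\xrightarrow{f} M^1\to\cdots\to M^d\xrightarrow{g} N\to 0$$ be a $d$-exact sequence in $\mathcal M$. Then there exist a $d$-exact sequence $$\varepsilon\colon\quad 0\to L_X\xrightarrow{f_X} M^1_X\to\cdots\to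 M^d_X\xrightarrow{g_X} N\to 0$$ in $\mathcal M$ and a morphism of complexes $\delta\to\varepsilon$ which is the identity on $N$ and whose restriction from $L\to M^1\to\cdots\to M^d$ to $L_X\to M^1_X\to\cdots\to M^d_X$ is a $d$-pushout diagram in $\mathcal M$, such that (i) the morphism $g_X$ is right $X$-determined in $\mathcal M$; (ii) $\operatorname{Im}\operatorname{Hom}_\Lambda(X,g_X)=\operatorname{Im}\operatorname{Hom}_\Lambda(X,g)$. -/

import Mathlib

open CategoryTheory CategoryTheory.Limits

universe u

noncomputable section

namespace HigherAR

section Sequences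

variable {C : Type*} [Category C] [Preadditive C]

/-- A sequence of morphisms `X⁰ ⟶ X¹ ⟶ X² ⟶ ⋯` in `C`. All notions below take a number `d` and
look at the initial part `X⁰ ⟶ X¹ ⟶ ⋯ ⟶ Xᵈ` only, so that this structure represents finite
sequences; terms and morphisms beyond the index `d` play no role. -/
structure ArrowSeq (C : Type*) [Category C] where
  obj : ℕ → C
  map : ∀ i, obj i ⟶ obj (i + 1)

/-- For every `X` in `P` the sequence
`0 → Hom(X, M⁰) → Hom(X, M¹) → ⋯ → Hom(X, Mᵈ) → Hom(X, N)` is exact. -/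
def HomFromExact (P : ObjectProperty C) :
    (d : ℕ) → (M : ArrowSeq C) → {N : C} → (M.obj d ⟶ N) → Prop
  | 0, M, _, g => ∀ X, P X → Function.Injective (fun φ : X ⟶ M.obj 0 => φ ≫ g)
  | n + 1, M, _, g => ∀ X, P X →
      Function.Injective (fun φ : X ⟶ M.obj 0 => φ ≫ M.map 0) ∧
      (∀ i < n, Function.Exact (fun φ : X ⟶ M.obj i => φ ≫ M.map i)
        (fun φ : X ⟶ M.obj (i + 1) => φ ≫ M.map (i + 1))) ∧
      Function.Exact (fun φ : X ⟶ M.obj n => φ ≫ M.map n)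
        (fun φ : X ⟶ M.obj (n + 1) => φ ≫ g)

/-- For every `Y` in `P` the sequence
`0 → Hom(N, Y) → Hom(Mᵈ, Y) → ⋯ → Hom(M¹, Y) → Hom(M⁰, Y)` is exact. -/
def HomToExact (P : ObjectProperty C) :
    (d : ℕ) → (M : ArrowSeq C) → {N : C} → (M.obj d ⟶ N) → Prop
  | 0, _, N, g => ∀ Y, P Y → Function.Injective (fun φ : N ⟶ Y => g ≫ φ)
  | n + 1, M, N, g => ∀ Y, P Y →
      Function.Injective (fun φ : N ⟶ Y => g ≫ φ) ∧
      Function.Exact (fun φ : N ⟶ Y => g ≫ φ)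
        (fun φ : M.obj (n + 1) ⟶ Y => M.map n ≫ φ) ∧
      (∀ i < n, Function.Exact (fun φ : M.obj (i + 2) ⟶ Y => M.map (i + 1) ≫ φ)
        (fun φ : M.obj (i + 1) ⟶ Y => M.map i ≫ φ))

/-- The composite `Mᵈ⁻¹ ⟶ Mᵈ ⟶ N` is zero (no condition if `d = 0`). -/
def CompLastZero : (d : ℕ) → (M : ArrowSeq C) → {N : C} → (M.obj d ⟶ N) → Prop
  | 0, _, _, _ => True
  | n + 1, M, _, g => M.map n ≫ g = 0

/-- `M⁰ ⟶ M¹ ⟶ ⋯ ⟶ Mᵈ ⟶ N` (with last morphism `g`) is a complex all of whose terms lie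
in `P`. -/
structure IsComplexIn (P : ObjectProperty C) (d : ℕ) (M : ArrowSeq C) {N : C}
    (g : M.obj d ⟶ N) : Prop where
  mem : ∀ i ≤ d, P (M.obj i)
  mem_last : P N
  comp_zero : ∀ i, i + 1 < d → M.map i ≫ M.map (i + 1) = 0
  comp_last : CompLastZero d M g

/-- `M⁰ ⟶ M¹ ⟶ ⋯ ⟶ Mᵈ ⟶ N` is a left `d`-exact sequence in `P`. -/
structure IsLeftDExact (P : ObjectProperty C) (d : ℕ) (M : ArrowSeq C) {N : C}
    (g : M.obj d ⟶ N) : Prop where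
  isComplex : IsComplexIn P d M g
  exact : HomFromExact P d M g

/-- `M⁰ ⟶ M¹ ⟶ ⋯ ⟶ Mᵈ ⟶ N` is a right `d`-exact sequence in `P`. -/
structure IsRightDExact (P : ObjectProperty C) (d : ℕ) (M : ArrowSeq C) {N : C}
    (g : M.obj d ⟶ N) : Prop where
  isComplex : IsComplexIn P d M g
  exact : HomToExact P d M g

/-- `M⁰ ⟶ M¹ ⟶ ⋯ ⟶ Mᵈ ⟶ N` is a `d`-exact sequence in `P`. -/
structure IsDExact (P : ObjectProperty C) (d : ℕ) (M : ArrowSeq C) {N : C}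
    (g : M.obj d ⟶ N) : Prop where
  left : IsLeftDExact P d M g
  right : IsRightDExact P d M g

/-- The family `u` is a morphism of complexes from `M⁰ ⟶ ⋯ ⟶ Mᵈ` to `N⁰ ⟶ ⋯ ⟶ Nᵈ`. -/
structure IsComplexMorphism (d : ℕ) (M N : ArrowSeq C) (u : ∀ i, M.obj i ⟶ N.obj i) :
    Prop where
  comp_zero_source : ∀ i, i + 1 < d → M.map i ≫ M.map (i + 1) = 0
  comp_zero_target : ∀ i, i + 1 < d → N.map i ≫ N.map (i + 1) = 0
  comm : ∀ i < d, M.map i ≫ u (i + 1) = u i ≫ N.map i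

variable [HasBinaryBiproducts C]

/-- The terms `M⁰`, `M¹ ⊞ N⁰`, `M² ⊞ N¹`, … of the mapping cone. -/
def coneObj (M N : ArrowSeq C) : ℕ → C
  | 0 => M.obj 0
  | i + 1 => M.obj (i + 1) ⊞ N.obj i

/-- The morphisms of the mapping cone except for the last one: the first one has the components
`-f⁰` and `u⁰`, and `Mⁱ⁺¹ ⊞ Nⁱ ⟶ Mⁱ⁺² ⊞ Nⁱ⁺¹` has the components `-fⁱ⁺¹ : Mⁱ⁺¹ ⟶ Mⁱ⁺²`,
`uⁱ⁺¹ : Mⁱ⁺¹ ⟶ Nⁱ⁺¹`, `0 : Nⁱ ⟶ Mⁱ⁺²` and `gⁱ : Nⁱ ⟶ Nⁱ⁺¹`. -/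
def coneMap (M N : ArrowSeq C) (u : ∀ i, M.obj i ⟶ N.obj i) :
    ∀ i, coneObj M N i ⟶ coneObj M N (i + 1)
  | 0 => biprod.lift (-M.map 0) (u 0)
  | i + 1 => Biprod.ofComponents (-M.map (i + 1)) (u (i + 1)) 0 (N.map i)

/-- The sequence `M⁰ ⟶ M¹ ⊞ N⁰ ⟶ M² ⊞ N¹ ⟶ ⋯`. -/
def cone (M N : ArrowSeq C) (u : ∀ i, M.obj i ⟶ N.obj i) : ArrowSeq C where
  obj := coneObj M N
  map := coneMap M N u

/-- The last morphism `Mᵈ ⊞ Nᵈ⁻¹ ⟶ Nᵈ` of the mapping cone, with components `uᵈ` and `gᵈ⁻¹`. -/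
def coneLast (M N : ArrowSeq C) (u : ∀ i, M.obj i ⟶ N.obj i) :
    (d : ℕ) → ((cone M N u).obj d ⟶ N.obj d)
  | 0 => u 0
  | n + 1 => biprod.desc (u (n + 1)) (N.map n)

/-- The morphism of complexes `u` from `M⁰ ⟶ ⋯ ⟶ Mᵈ` to `N⁰ ⟶ ⋯ ⟶ Nᵈ` is a `d`-pushout
diagram in `P`: its mapping cone
`M⁰ ⟶ M¹ ⊞ N⁰ ⟶ ⋯ ⟶ Mᵈ ⊞ Nᵈ⁻¹ ⟶ Nᵈ` is a right `d`-exact sequence in `P`. -/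
structure IsDPushout (P : ObjectProperty C) (d : ℕ) (M N : ArrowSeq C)
    (u : ∀ i, M.obj i ⟶ N.obj i) : Prop where
  isMorphism : IsComplexMorphism d M N u
  exact : IsRightDExact P d (cone M N u) (coneLast M N u d)

/-- The image of `Hom(X, g) : Hom(X, M) → Hom(X, N)`. -/
def imHom (X : C) {M N : C} (g : M ⟶ N) : Set (X ⟶ N) :=
  Set.range (fun φ : X ⟶ M => φ ≫ g)

/-- The morphism `g` is right `X`-determined in `P`. -/
def IsRightDetermined (P : ObjectProperty C) (X : C) {M N : C} (g : M ⟶ N) : Prop :=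
  ∀ (V : C), P V → ∀ h : V ⟶ N, imHom X h ⊆ imHom X g → ∃ w : V ⟶ M, w ≫ g = h

end Sequences

section ClusterTilting

variable (Λ : Type u) [Ring Λ]

/-- The full subcategory of the finite length modules inside the category of all right
`Λ`-modules. -/
def finLength : ObjectProperty (ModuleCat.{u} Λᵐᵒᵖ) :=
  fun X => IsFiniteLength Λᵐᵒᵖ X

variable {Λ}

/-- Every `M` of finite length has a right `P`-approximation. -/
def IsContravariantlyFinite (P : ObjectProperty (ModuleCat.{u} Λᵐᵒᵖ)) : Prop :=
  ∀ M, finLength Λ M → ∃ X, P X ∧ ∃ f : X ⟶ M,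
    ∀ X', P X' → Function.Surjective (fun φ : X' ⟶ X => φ ≫ f)

/-- Every `M` of finite length has a left `P`-approximation. -/
def IsCovariantlyFinite (P : ObjectProperty (ModuleCat.{u} Λᵐᵒᵖ)) : Prop :=
  ∀ M, finLength Λ M → ∃ X, P X ∧ ∃ f : M ⟶ X,
    ∀ X', P X' → Function.Surjective (fun φ : X ⟶ X' => f ≫ φ)

/-- `P` is a `d`-cluster-tilting subcategory of the category of finite length right `Λ`-modules.
The two equalities imply that `P` consists of modules of finite length and is closed under
isomorphisms, finite direct sums and direct summands. -/
structure IsClusterTilting (d : ℕ) (P : ObjectProperty (ModuleCat.{u} Λᵐᵒᵖ)) : Prop where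
  contravariantlyFinite : IsContravariantlyFinite P
  covariantlyFinite : IsCovariantlyFinite P
  mem_iff_ext_to : ∀ X, P X ↔ finLength Λ X ∧
    ∀ Y, P Y → ∀ k, 0 < k → k < d → Subsingleton (Abelian.Ext X Y k)
  mem_iff_ext_from : ∀ Y, P Y ↔ finLength Λ Y ∧
    ∀ X, P X → ∀ k, 0 < k → k < d → Subsingleton (Abelian.Ext X Y k)

end ClusterTilting

end HigherAR

end

/-! Put `H = Im Hom(X, g)`. The core is a finitely generated module `K` over `N` that is weakly
terminal among all modules `V` over `N` whose maps from `X` land in `H` (`exists_universal_over`). A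
right approximation `Y ⟶ K` by an object of `P` then gives `g_X : Y ⟶ K ⟶ N`. Maps from `X` through
`K` land in `H`, and anything in `P` with this property factors through `K`, hence through `Y`; so
`g_X` is right `X`-determined. Since `g` itself factors through `g_X`, both images equal `H`, and
`g_X` is onto because `g` is.

To build `K`, take a presentation `A^m → A^n → X` and embed `Hom(X, N) / H` in a finitely generated
injective `R`-module `E`. The resulting functional on `Hom(X, N)` extends to `N^n → E`, which
amounts to an `A`-linear map `N → Hom_R(A, E)^n`. `K` is its pullback along the transposed
presentation `Hom_R(A, E)^m → Hom_R(A, E)^n`, whose kernel plays the role of the Auslander-Reiten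
translate of `X`.

The rest is homological. Vanishing of `Ext` in degrees `0 < k < d` makes exact sequences with terms
in `P` `d`-exact; conversely `d`-exact sequences are exact, because `P` contains the regular module
and the finitely generated injectives (`isExactSeq_of_isDExact`). Iterated approximations of kernels
complete `g_X` to an exact sequence, comparison of complexes gives `δ → ε`, and its mapping cone,
with `N` omitted, is exact (`isExactSeq_cone`), hence right `d`-exact. -/

namespace HigherAR

/-! ### Finitely generated injectives over a commutative artinian ring -/

section InjectiveEmbedding

/-- A submodule of an injective module has an injective hull inside that module. -/
theorem exists_injective_hull_of_le {R I : Type u} [Ring R] [AddCommGroup I] [Module R I]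
    [Module.Injective R I] (W : Submodule R I) :
    ∃ E : Submodule R I, W ≤ E ∧ (∀ B ≤ E, Disjoint B W → B = ⊥) ∧ Module.Injective R E := by
  obtain ⟨E, -, hE⟩ := zorn_le_nonempty₀
    {E : Submodule R I | W ≤ E ∧ ∀ B ≤ E, Disjoint B W → B = ⊥}
    (fun c hc hchain y hy => by
      refine ⟨sSup c, ⟨(hc hy).1.trans (le_sSup hy), fun B hB hBW => ?_⟩, fun z hz => le_sSup hz⟩
      refine (Submodule.eq_bot_iff _).2 fun x hx => ?_
      obtain ⟨F, hF, hxF⟩ := (Submodule.mem_sSup_of_directed ⟨y, hy⟩ hchain.directedOn).1 (hB hx)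
      have hle : Submodule.span R {x} ≤ B := by simpa using hx
      simpa using (hc hF).2 (Submodule.span R {x}) (by simpa using hxF) (hBW.mono_left hle))
    W ⟨le_rfl, fun B hB hBW => by simpa using hBW.eq_bot_of_le hB⟩
  obtain ⟨⟨hWE, hess⟩, hmax⟩ := hE
  -- `E` is a maximal essential extension of `W` in `I`. With a maximal `C` disjoint from `E`, the
  -- map `E → I ⧸ C` is injective, so the inclusion of `E` extends to an endomorphism `ψ` of `I`
  -- that is the identity on `E` and zero on `C`.
  obtain ⟨C, -, hC, hCmax⟩ := zorn_le_nonempty₀ {C : Submodule R I | Disjoint C E}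
    (fun c hc hchain y hy => by
      refine ⟨sSup c, ?_, fun z hz => le_sSup hz⟩
      exact hchain.directedOn.disjoint_sSup_left.2 fun C hC => hc hC)
    ⊥ disjoint_bot_left
  obtain ⟨φ, hφ⟩ := Module.Injective.extension_property R I E (I ⧸ C) (C.mkQ ∘ₗ E.subtype)
    (by
      rw [← LinearMap.ker_eq_bot, LinearMap.ker_comp, Submodule.ker_mkQ]
      exact Submodule.disjoint_iff_comap_eq_bot.1 hC.symm) E.subtype
  let ψ : I →ₗ[R] I := φ ∘ₗ C.mkQ
  have hψ : ∀ e ∈ E, ψ e = e := fun e he => LinearMap.congr_fun hφ ⟨e, he⟩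
  have hψC : ∀ c ∈ C, ψ c = 0 := fun c hc => by
    simp [ψ, (Submodule.Quotient.mk_eq_zero C).2 hc]
  have hpre : ∀ B : Submodule R I, Disjoint (B ⊓ E) W → B.comap ψ ≤ C := by
    intro B hB
    refine hCmax (y := B.comap ψ) ?_ fun c hc => by simp [hψC c hc]
    refine Submodule.disjoint_def.2 fun x hx hxE => ?_
    rw [Submodule.mem_comap, hψ x hxE] at hx
    have := hess (B ⊓ E) inf_le_right hB
    simpa using this.le ⟨hx, hxE⟩
  -- The range of `ψ` is again essential over `W`: a submodule of it disjoint from `W` has its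
  -- preimage inside `C`, which `ψ` kills. Maximality of `E` makes `ψ` a retraction onto `E`.
  have hrange : LinearMap.range ψ ≤ E := by
    refine hmax (y := LinearMap.range ψ) ⟨fun w hw => ⟨w, hψ w (hWE hw)⟩, fun B hB hBW => ?_⟩
      fun e he => ⟨e, hψ e he⟩
    refine (Submodule.eq_bot_iff _).2 fun x hx => ?_
    obtain ⟨y, rfl⟩ := hB hx
    exact hψC y (hpre B (hBW.mono_left inf_le_left) hx)
  refine ⟨E, hWE, hess, ⟨fun X Y _ _ _ _ f hf g => ?_⟩⟩
  obtain ⟨h, hh⟩ := Module.Injective.extension_property R I X Y f hf (E.subtype ∘ₗ g)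
  refine ⟨(ψ.codRestrict E fun x => hrange ⟨x, rfl⟩) ∘ₗ h, fun x => Subtype.ext ?_⟩
  have hx : h (f x) = g x := LinearMap.congr_fun hh x
  simp [hx, hψ]

/-- The action factors through the semisimple ring `R / J`, and the submodules are the same over
both rings. -/
theorem isSemisimpleModule_of_isTorsionBySet_jacobson {R M : Type*} [Ring R] [IsSemiprimaryRing R]
    [AddCommGroup M] [Module R M] (h : Module.IsTorsionBySet R M (Ring.jacobson R)) :
    IsSemisimpleModule R M := by
  have := ((isSemiprimaryRing_iff R).mp inferInstance).1
  let _ := h.module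
  exact (h.semilinearMap.isSemisimpleModule_iff_of_bijective Function.bijective_id).2
    inferInstance

/-- An essential extension of a noetherian module over a commutative artinian ring is
noetherian. -/
theorem isNoetherian_of_essential {R E : Type*} [CommRing R] [IsArtinianRing R]
    [AddCommGroup E] [Module R E] (W : Submodule R E) [IsNoetherian R W]
    (hess : ∀ B : Submodule R E, Disjoint B W → B = ⊥) : IsNoetherian R E := by
  set J := Ring.jacobson R
  obtain ⟨-, n, hn⟩ := (isSemiprimaryRing_iff R).mp inferInstance
  let T : ℕ → Submodule R E := fun k => Submodule.torsionBySet R E (J ^ k : Ideal R)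
  have memT : ∀ k x, x ∈ T k ↔ ∀ a ∈ J ^ k, a • x = 0 := fun k x => by
    simp [T, Submodule.mem_torsionBySet_iff]
  -- `T 1` is semisimple, so `W ∩ T 1` has a complement in it; that complement is disjoint from `W`,
  -- hence zero.
  have hT1 : T 1 ≤ W := by
    have : IsSemisimpleModule R (T 1) := isSemisimpleModule_of_isTorsionBySet_jacobson
      fun x a => Subtype.ext ((memT 1 _).1 x.2 a (by simp [J]))
    obtain ⟨C, hC⟩ := exists_isCompl (W.comap (T 1).subtype)
    have h0 : C.map (T 1).subtype = ⊥ := by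
      refine hess _ (Submodule.disjoint_def.2 ?_)
      rintro _ ⟨x, hx, rfl⟩ hxW
      simpa using Submodule.disjoint_def.1 hC.disjoint x hxW hx
    have hC0 : C = ⊥ :=
      Submodule.map_injective_of_injective (T 1).injective_subtype (by rw [h0, Submodule.map_bot])
    have htop : W.comap (T 1).subtype = ⊤ := by simpa [hC0] using hC.sup_eq_top
    exact Submodule.comap_subtype_eq_top.1 htop
  have hT : ∀ k, IsNoetherian R (T k) := by
    intro k
    induction k with
    | zero =>
      have : T 0 = ⊥ := (Submodule.eq_bot_iff _).2 fun x hx => by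
        simpa using (memT 0 x).1 hx 1 (by simp)
      rw [this]
      infer_instance
    | succ k ih =>
      obtain ⟨s, hs⟩ : J.FG := IsNoetherian.noetherian J
      -- Multiplication by finitely many generators of `J` sends `T (k + 1)` to a finite power of `T
      -- k`, with kernel inside `T 1 ≤ W`. Nilpotency of `J` ends the induction at `T n = ⊤`.
      let f : T (k + 1) →ₗ[R] (s → T k) := LinearMap.pi fun r =>
        (((r : R) • LinearMap.id : E →ₗ[R] E)).restrict (fun x hx => (memT k _).2 fun a ha => by
          have hr : (r : R) ∈ J := hs ▸ Ideal.subset_span r.2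
          have := (memT (k + 1) x).1 hx (a * r) (by
            rw [pow_succ]; exact Ideal.mul_mem_mul ha hr)
          simpa [mul_smul] using this)
      have hker : (LinearMap.ker f).map (T (k + 1)).subtype ≤ T 1 := by
        rintro _ ⟨x, hx, rfl⟩
        refine (memT 1 _).2 fun a ha => ?_
        rw [pow_one, ← hs] at ha
        refine Submodule.span_induction (p := fun a _ => a • (x : E) = 0) ?_ ?_ ?_ ?_ ha
        · intro r hr
          have := congrArg Subtype.val (congrFun (LinearMap.mem_ker.1 hx) ⟨r, hr⟩)
          simpa [f] using this
        · simp
        · intro a b _ _ ha hb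
          simp [add_smul, ha, hb]
        · intro a b _ hb
          simp [mul_smul, hb]
      have : IsNoetherian R (LinearMap.ker f) := by
        have := isNoetherian_of_le (hker.trans hT1)
        exact isNoetherian_of_linearEquiv
          ((LinearMap.ker f).equivMapOfInjective _ (T (k + 1)).injective_subtype).symm
      exact isNoetherian_of_range_eq_ker (LinearMap.ker f).subtype f (by simp)
  have htop : T n = ⊤ := (Submodule.eq_top_iff').2 fun x => (memT n x).2 fun a ha => by
    have ha' : a = 0 := by simpa [J, hn] using ha
    simp [ha']
  have := hT n
  rw [htop] at this
  exact isNoetherian_top_iff.1 this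

/-- Finitely generated modules over commutative artinian rings embed into finitely generated
injective modules. -/
theorem exists_finite_injective_embedding (R W : Type u) [CommRing R] [IsArtinianRing R]
    [AddCommGroup W] [Module R W] [Module.Finite R W] :
    ∃ (E : Type u) (_ : AddCommGroup E) (_ : Module R E) (ι : W →ₗ[R] E),
      Module.Injective R E ∧ Module.Finite R E ∧ Function.Injective ι := by
  obtain ⟨⟨I, hI, i, hi⟩⟩ := EnoughInjectives.presentation (ModuleCat.of R W)
  have hI' : Module.Injective R I := Module.injective_module_of_injective_object R I
  have hinj : Function.Injective i.hom := (ModuleCat.mono_iff_injective i).1 hi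
  obtain ⟨E, hWE, hess, hE⟩ := exists_injective_hull_of_le (LinearMap.range i.hom)
  refine ⟨E, inferInstance, inferInstance, i.hom.codRestrict E fun x => hWE ⟨x, rfl⟩, hE, ?_,
    fun x y h => hinj (congrArg Subtype.val h)⟩
  have hfin : Module.Finite R (LinearMap.range i.hom) := Module.Finite.range _
  have hn : IsNoetherian R ((LinearMap.range i.hom).comap E.subtype) :=
    isNoetherian_of_linearEquiv (Submodule.comapSubtypeEquivOfLe hWE).symm
  have := isNoetherian_of_essential ((LinearMap.range i.hom).comap E.subtype) fun B hB => by
    have := hess (B.map E.subtype) (Submodule.map_subtype_le _ _) (Submodule.disjoint_def.2 ?_)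
    · exact Submodule.map_injective_of_injective E.injective_subtype
        (by rw [this, Submodule.map_bot])
    · rintro _ ⟨x, hx, rfl⟩ hxW
      simpa using Submodule.disjoint_def.1 hB x hx hxW
  infer_instance

end InjectiveEmbedding
-- Coinduced modules and injectives over an Artin algebra
section Coinduction

/-- The `A`-module coinduced from the `R`-module `E`. -/
def Coind (R A E : Type*) [CommRing R] [Ring A] [Algebra R A] [AddCommGroup E] [Module R E] :=
  A →ₗ[R] E

namespace Coind

variable {R A E : Type*} [CommRing R] [Ring A] [Algebra R A] [AddCommGroup E] [Module R E]

instance : AddCommGroup (Coind R A E) := inferInstanceAs (AddCommGroup (A →ₗ[R] E))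

instance : Module R (Coind R A E) := inferInstanceAs (Module R (A →ₗ[R] E))

instance : FunLike (Coind R A E) A E := inferInstanceAs (FunLike (A →ₗ[R] E) A E)

@[ext] theorem ext {f g : Coind R A E} (h : ∀ a, f a = g a) : f = g := DFunLike.ext _ _ h

@[simp] theorem add_apply (f g : Coind R A E) (a : A) : (f + g) a = f a + g a := rfl

@[simp] theorem zero_apply (a : A) : (0 : Coind R A E) a = 0 := rfl

@[simp] theorem base_smul_apply (r : R) (f : Coind R A E) (a : A) : (r • f) a = r • f a := rfl

@[simp] theorem map_add (f : Coind R A E) (a b : A) : f (a + b) = f a + f b :=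
  LinearMap.map_add (f : A →ₗ[R] E) a b

@[simp] theorem map_zero (f : Coind R A E) : f 0 = 0 := LinearMap.map_zero (f : A →ₗ[R] E)

@[simp] theorem map_base_smul (f : Coind R A E) (r : R) (a : A) : f (r • a) = r • f a :=
  LinearMap.map_smul (f : A →ₗ[R] E) r a

instance : SMul A (Coind R A E) where
  smul a f := (f : A →ₗ[R] E) ∘ₗ LinearMap.mulRight R a

@[simp] theorem smul_apply (a b : A) (f : Coind R A E) : (a • f) b = f (b * a) := rfl

instance : Module A (Coind R A E) where
  one_smul f := by ext; simp
  mul_smul a b f := by ext; simp [mul_assoc]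
  smul_zero a := by ext; simp
  smul_add a f g := by ext; simp
  add_smul a b f := by ext; simp [mul_add]
  zero_smul f := by ext; simp

instance : IsScalarTower R A (Coind R A E) where
  smul_assoc r a f := by ext b; simp

/-- Evaluation at the unit, as an additive map into the underlying `R`-module. -/
def evalOne : Coind R A E →+ E where
  toFun f := f 1
  map_zero' := rfl
  map_add' _ _ := rfl

@[simp] theorem evalOne_apply (f : Coind R A E) : evalOne f = f 1 := rfl

/-- The `A`-linear map into the coinduced module corresponding to an `R`-linear map. -/
def curry {V : Type*} [AddCommGroup V] [Module R V] [Module A V] [IsScalarTower R A V]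
    (α : V →ₗ[R] E) : V →ₗ[A] Coind R A E where
  toFun v := α ∘ₗ (LinearMap.toSpanSingleton A V v).restrictScalars R
  map_add' v w := by
    refine ext fun a => ?_
    change α (a • (v + w)) = α (a • v) + α (a • w)
    rw [smul_add, α.map_add]
  map_smul' b v := by
    refine ext fun a => ?_
    change α (a • b • v) = α ((a * b) • v)
    rw [mul_smul]

@[simp] theorem curry_apply {V : Type*} [AddCommGroup V] [Module R V] [Module A V]
    [IsScalarTower R A V] (α : V →ₗ[R] E) (v : V) (a : A) : curry (A := A) α v a = α (a • v) := rfl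

theorem curry_injective {V : Type*} [AddCommGroup V] [Module R V] [Module A V]
    [IsScalarTower R A V] {α : V →ₗ[R] E} (hα : Function.Injective α) :
    Function.Injective (curry (A := A) α) := fun v w h => hα <| by
  simpa using DFunLike.congr_fun h (1 : A)

instance [IsArtinianRing R] [Module.Finite R A] [Module.Finite R E] :
    Module.Finite A (Coind R A E) := by
  have : Module.Finite R (Coind R A E) := inferInstanceAs (Module.Finite R (A →ₗ[R] E))
  exact Module.Finite.of_restrictScalars_finite R A _

end Coind

/-- Coinduction is right adjoint to restriction of scalars, which preserves injective maps: evaluate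
at `1`, extend over `R`, and return by `Coind.curry`. -/
theorem Coind.injective {R A E : Type u} [CommRing R] [Ring A] [Algebra R A] [AddCommGroup E]
    [Module R E] [Module.Injective R E] : Module.Injective A (Coind R A E) where
  out X Y _ _ _ _ f hf g := by
    let _ : Module R X := Module.compHom X (algebraMap R A)
    let _ : Module R Y := Module.compHom Y (algebraMap R A)
    have : IsScalarTower R A X := IsScalarTower.of_algebraMap_smul fun _ _ => rfl
    have : IsScalarTower R A Y := IsScalarTower.of_algebraMap_smul fun _ _ => rfl
    let g₁ : X →ₗ[R] E :=
      { toFun x := g x 1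
        map_add' x y := by simp
        map_smul' r x := by
          change g (algebraMap R A r • x) 1 = r • g x 1
          rw [g.map_smul, algebraMap_smul, Coind.base_smul_apply] }
    obtain ⟨h, hh⟩ := Module.Injective.out (f.restrictScalars R) hf g₁
    refine ⟨Coind.curry h, fun x => Coind.ext fun a => ?_⟩
    have := hh (a • x)
    simpa [g₁] using this

/-- Finitely generated modules over an Artin algebra embed into finitely generated injective
modules. -/
theorem exists_finite_injective_embedding_of_algebra (R A W : Type u) [CommRing R]
    [IsArtinianRing R] [Ring A] [Algebra R A] [Module.Finite R A]
    [AddCommGroup W] [Module A W] [Module.Finite A W] :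
    ∃ (E : Type u) (_ : AddCommGroup E) (_ : Module A E) (ι : W →ₗ[A] E),
      Module.Injective A E ∧ Module.Finite A E ∧ Function.Injective ι := by
  let _ : Module R W := Module.compHom W (algebraMap R A)
  have : IsScalarTower R A W := IsScalarTower.of_algebraMap_smul fun _ _ => rfl
  have : Module.Finite R W := Module.Finite.trans A W
  obtain ⟨E, _, _, ι, _, _, hι⟩ := exists_finite_injective_embedding R W
  exact ⟨Coind R A E, inferInstance, inferInstance, Coind.curry ι, Coind.injective,
    inferInstance, Coind.curry_injective hι⟩

end Coinduction

/-! ### The universal module over `N` attached to `X` and `H` -/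

section Determiner

theorem exists_comp_eq_of_ker_le {R V W E : Type u} [Ring R] [AddCommGroup V] [Module R V]
    [AddCommGroup W] [Module R W] [AddCommGroup E] [Module R E] [Module.Injective R E]
    (ρ : V →ₗ[R] W) (Φ : V →ₗ[R] E) (h : LinearMap.ker ρ ≤ LinearMap.ker Φ) :
    ∃ B : W →ₗ[R] E, B ∘ₗ ρ = Φ := by
  obtain ⟨B, hB⟩ := Module.Injective.out ((LinearMap.ker ρ).liftQ ρ le_rfl)
    (LinearMap.ker_eq_bot.1 (Submodule.ker_liftQ_eq_bot _ _ _ le_rfl))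
    ((LinearMap.ker ρ).liftQ Φ h)
  exact ⟨B, LinearMap.ext fun v => by simpa using hB (Submodule.Quotient.mk v)⟩

/-- Let `H` be a set of morphisms `X → N` that is an `R`-submodule of `Hom(X, N)`. There is a
finitely generated module `K` over `N` such that `Hom(X, K)` is mapped into `H`, and every `V`
over `N` such that `Hom(X, V)` is mapped into `H` admits a morphism to `K` over `N`. -/
theorem exists_universal_over {R A X N : Type u} [CommRing R] [IsArtinianRing R] [Ring A]
    [Algebra R A] [Module.Finite R A]
    [AddCommGroup X] [Module A X] [Module.Finite A X]
    [AddCommGroup N] [Module R N] [Module A N] [IsScalarTower R A N] [Module.Finite A N]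
    (H : Submodule R (X →ₗ[A] N)) :
    ∃ (K : Type u) (_ : AddCommGroup K) (_ : Module A K) (π : K →ₗ[A] N),
      Module.Finite A K ∧ (∀ f : X →ₗ[A] K, π ∘ₗ f ∈ H) ∧
      ∀ (V : Type u) [AddCommGroup V] [Module A V] (h : V →ₗ[A] N),
        (∀ f : X →ₗ[A] V, h ∘ₗ f ∈ H) → ∃ h' : V →ₗ[A] K, π ∘ₗ h' = h := by
  have : IsArtinianRing A := IsArtinianRing.of_finite R A
  have : Module.Finite R N := Module.Finite.trans A N
  -- A presentation of `X`: generators `x j`, and relations `r k` spanning the kernel of `p`.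
  obtain ⟨n, p, hp⟩ := Module.Finite.exists_fin' A X
  obtain ⟨m, q, hq⟩ := Module.Finite.exists_fin' A (LinearMap.ker p)
  let r : Fin m → Fin n → A := fun k => (q (Pi.single k 1) : Fin n → A)
  have hr : ∀ k, p (r k) = 0 := fun k => LinearMap.mem_ker.1 (q (Pi.single k 1)).2
  have hspan : ∀ y, p y = 0 → y ∈ Submodule.span A (Set.range r) := by
    intro y hy
    obtain ⟨c, hc⟩ := hq ⟨y, hy⟩
    have hy' : y = ∑ k, c k • r k := by
      have : c = ∑ k, c k • (Pi.single k 1 : Fin m → A) := by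
        ext j; simp [Finset.sum_apply, Pi.single_apply]
      rw [this, map_sum] at hc
      simpa [r] using (congrArg Subtype.val hc).symm
    rw [hy']
    exact Submodule.sum_mem _ fun k _ => Submodule.smul_mem _ _ (Submodule.subset_span ⟨k, rfl⟩)
  let x : Fin n → X := fun j => p (Pi.single j 1)
  have hx : ∀ c : Fin n → A, p c = ∑ j, c j • x j := by
    intro c
    have : c = ∑ j, c j • (Pi.single j 1 : Fin n → A) := by
      ext j; simp [Finset.sum_apply, Pi.single_apply]
    conv_lhs => rw [this]
    simp [x]
  let ev : (X →ₗ[A] N) →ₗ[R] (Fin n → N) :=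
    { toFun f j := f (x j)
      map_add' _ _ := rfl
      map_smul' _ _ := rfl }
  have hev : Function.Injective ev := by
    intro f g hfg
    refine LinearMap.ext fun y => ?_
    obtain ⟨c, rfl⟩ := hp y
    simp only [hx, map_sum, map_smul]
    exact Finset.sum_congr rfl fun j _ => congrArg _ (congrFun hfg j)
  have : Module.Finite R (X →ₗ[A] N) := Module.Finite.of_injective ev hev
  -- `ι` detects membership in `H`; injectivity of `E` extends it along `ev` to a functional `Θ` on
  -- all of `N^n`.
  obtain ⟨E, _, _, ι, _, _, hι⟩ := exists_finite_injective_embedding R ((X →ₗ[A] N) ⧸ H)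
  obtain ⟨Θ, hΘ⟩ := Module.Injective.out ev hev (ι ∘ₗ H.mkQ)
  have hH : ∀ f, f ∈ H ↔ Θ (ev f) = 0 := fun f => by
    rw [hΘ, LinearMap.comp_apply, map_eq_zero_iff ι hι, Submodule.mkQ_apply,
      Submodule.Quotient.mk_eq_zero]
  -- The pullback of the map `N → Hom_R(A, E)^n` induced by `Θ` and the transpose of the relation
  -- matrix. It is finitely generated because `A` is artinian.
  let K : Submodule A (N × (Fin m → Coind R A E)) :=
    { carrier := {z | ∀ j (a : A), Θ (Pi.single j (a • z.1)) = ∑ k, z.2 k (r k j * a)}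
      add_mem' := fun {z w} hz hw j a => by
        simp [Pi.single_add, hz j a, hw j a, Finset.sum_add_distrib]
      zero_mem' := fun j a => by simp
      smul_mem' := fun b z hz j a => by
        have := hz j (a * b)
        simpa [mul_smul, mul_assoc] using this }
  refine ⟨K, inferInstance, inferInstance, LinearMap.fst A _ _ ∘ₗ K.subtype, inferInstance, ?_, ?_⟩
  · intro f
    rw [hH]
    have h1 : ev ((LinearMap.fst A _ _ ∘ₗ K.subtype) ∘ₗ f) =
        ∑ j, Pi.single j ((1 : A) • ((f (x j) : N × (Fin m → Coind R A E)).1)) := by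
      ext j; simp [ev, Finset.sum_apply, Pi.single_apply]
    rw [h1, map_sum]
    have h2 := fun j => (f (x j)).2 j 1
    simp only [mul_one] at h2
    rw [Finset.sum_congr rfl fun j _ => h2 j, Finset.sum_comm]
    refine Finset.sum_eq_zero fun k _ => ?_
    -- The defining equations at `a = 1` turn `Θ (ev (π ∘ f))` into a sum over `k` of these
    -- relations, evaluated at `1` in the `k`-th coinduced coordinate.
    have h3 : ∑ j, r k j • f (x j) = 0 := by
      rw [← map_zero f, ← hr k, hx, map_sum]
      simp
    have h4 := congrArg (fun z : K => Coind.evalOne ((z : N × (Fin m → Coind R A E)).2 k)) h3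
    simpa [Prod.snd_sum, Finset.sum_apply, map_sum] using h4
  · intro V _ _ h hh
    let _ : Module R V := Module.compHom V (algebraMap R A)
    have : IsScalarTower R A V := IsScalarTower.of_algebraMap_smul fun _ _ => rfl
    let Φ : (Fin n → V) →ₗ[R] E := Θ ∘ₗ
      { toFun v j := h (v j)
        map_add' v w := by ext; simp
        map_smul' c v := by
          ext j
          exact (h.restrictScalars R).map_smul c (v j) }
    let ρ : (Fin n → V) →ₗ[R] (Fin m → V) :=
      { toFun v k := ∑ j, r k j • v j
        map_add' v w := by ext; simp [Finset.sum_add_distrib]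
        map_smul' c v := by
          ext k
          simp only [Pi.smul_apply, RingHom.id_apply, Finset.smul_sum]
          exact Finset.sum_congr rfl fun j _ => smul_comm _ _ _ }
    -- The kernel of `ρ` is `Hom(X, V)`, given by values on the generators. There `Φ` vanishes
    -- because `h` carries these maps into `H`, so `Φ` factors through `ρ`.
    obtain ⟨B, hB⟩ := exists_comp_eq_of_ker_le ρ Φ (by
      intro v hv
      have hv' : ∀ k, ∑ j, r k j • v j = 0 := fun k => congrFun (LinearMap.mem_ker.1 hv) k
      let l : (Fin n → A) →ₗ[A] V := Fintype.linearCombination A v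
      have hker : LinearMap.ker p ≤ LinearMap.ker l := fun y hy =>
        (Submodule.span_le.2 (by
          rintro _ ⟨k, rfl⟩
          simpa [l, Fintype.linearCombination_apply] using hv' k)) (hspan y hy)
      let e := p.quotKerEquivOfSurjective hp
      let f : X →ₗ[A] V := (LinearMap.ker p).liftQ l hker ∘ₗ e.symm.toLinearMap
      have hf : ∀ j, f (x j) = v j := by
        intro j
        have : e.symm (x j) = Submodule.Quotient.mk (Pi.single j 1) := by
          rw [LinearEquiv.symm_apply_eq]
          rfl
        simp [f, this, l, Fintype.linearCombination_apply_single]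
      have := (hH _).1 (hh f)
      have hev' : ev (h ∘ₗ f) = fun j => h (v j) := funext fun j => congrArg h (hf j)
      rw [hev'] at this
      exact this)
    -- The `k`-th coinduced coordinate of `v` is `a ↦ B (a • v in place k)`; `B ∘ ρ = Φ` on vectors
    -- with one nonzero entry is exactly the equation defining `K`.
    refine ⟨LinearMap.codRestrict K (LinearMap.prod h (LinearMap.pi fun k =>
      Coind.curry (B ∘ₗ LinearMap.single R (fun _ => V) k))) fun v j a => ?_, LinearMap.ext fun v => rfl⟩
    have h5 := LinearMap.congr_fun hB (Pi.single j (a • v))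
    have h6 : Φ (Pi.single j (a • v)) = Θ (Pi.single j (a • h v)) := by
      refine congrArg Θ (funext fun i => ?_)
      by_cases hij : i = j
      · subst hij; simp
      · simp [Pi.single_eq_of_ne hij]
    have h7 : ρ (Pi.single j (a • v)) = ∑ k, Pi.single k ((r k j * a) • v) := by
      ext k
      simp [ρ, Finset.sum_apply, Pi.single_apply, mul_smul]
    rw [LinearMap.comp_apply, h6, h7, map_sum] at h5
    simpa using h5.symm

end Determiner
-- Consequences of vanishing `Ext` along a short exact sequence
section ExtVanishing

open Abelian

variable {C : Type*} [Category C] [Abelian C] [HasExt C] {S : ShortComplex C}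

theorem exists_lift_of_subsingleton_ext (hS : S.ShortExact) {X : C}
    (h : Subsingleton (Ext X S.X₁ 1)) (φ : X ⟶ S.X₃) : ∃ ψ : X ⟶ S.X₂, ψ ≫ S.g = φ := by
  obtain ⟨x, hx⟩ := Ext.covariant_sequence_exact₃ X hS (Ext.mk₀ φ) (zero_add 1)
    (Subsingleton.elim _ _)
  obtain ⟨ψ, rfl⟩ := (Ext.mk₀_bijective X S.X₂).2 x
  rw [Ext.mk₀_comp_mk₀] at hx
  exact ⟨ψ, (Ext.mk₀_bijective X S.X₃).1 hx⟩

theorem exists_desc_of_subsingleton_ext (hS : S.ShortExact) {Y : C}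
    (h : Subsingleton (Ext S.X₃ Y 1)) (φ : S.X₁ ⟶ Y) : ∃ ψ : S.X₂ ⟶ Y, S.f ≫ ψ = φ := by
  obtain ⟨x, hx⟩ := Ext.contravariant_sequence_exact₁ hS Y (Ext.mk₀ φ) (add_zero 1)
    (Subsingleton.elim _ _)
  obtain ⟨ψ, rfl⟩ := (Ext.mk₀_bijective S.X₂ Y).2 x
  rw [Ext.mk₀_comp_mk₀] at hx
  exact ⟨ψ, (Ext.mk₀_bijective S.X₁ Y).1 hx⟩

theorem subsingleton_ext_X₃ (hS : S.ShortExact) {X : C} {k : ℕ}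
    (h₂ : Subsingleton (Ext X S.X₂ k)) (h₁ : Subsingleton (Ext X S.X₁ (k + 1))) :
    Subsingleton (Ext X S.X₃ k) :=
  subsingleton_of_forall_eq 0 fun x => by
    obtain ⟨y, rfl⟩ := Ext.covariant_sequence_exact₃ X hS x rfl (Subsingleton.elim _ _)
    rw [Subsingleton.elim y 0, Ext.zero_comp]

theorem subsingleton_ext_X₁ (hS : S.ShortExact) {Y : C} {k : ℕ}
    (h₂ : Subsingleton (Ext S.X₂ Y k)) (h₃ : Subsingleton (Ext S.X₃ Y (k + 1))) :
    Subsingleton (Ext S.X₁ Y k) :=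
  subsingleton_of_forall_eq 0 fun x => by
    obtain ⟨y, rfl⟩ := Ext.contravariant_sequence_exact₁ hS Y x (add_comm 1 k)
      (Subsingleton.elim _ _)
    rw [Subsingleton.elim y 0, Ext.comp_zero]

theorem subsingleton_ext_X₂ (hS : S.ShortExact) {Y : C} {k : ℕ}
    (h₁ : Subsingleton (Ext S.X₁ Y k)) (h₃ : Subsingleton (Ext S.X₃ Y k)) :
    Subsingleton (Ext S.X₂ Y k) :=
  subsingleton_of_forall_eq 0 fun x => by
    obtain ⟨y, rfl⟩ := Ext.contravariant_sequence_exact₂ hS Y x (Subsingleton.elim _ _)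
    rw [Subsingleton.elim y 0, Ext.comp_zero]

/-- Dimension shifting for the first term of a short exact sequence. -/
theorem subsingleton_ext_succ_X₁ (hS : S.ShortExact) {X : C} {k : ℕ}
    (h₂ : Subsingleton (Ext X S.X₂ (k + 1))) (h₃ : Subsingleton (Ext X S.X₃ k)) :
    Subsingleton (Ext X S.X₁ (k + 1)) :=
  subsingleton_of_forall_eq 0 fun x => by
    obtain ⟨y, rfl⟩ := Ext.covariant_sequence_exact₁ X hS x (Subsingleton.elim _ _) rfl
    rw [Subsingleton.elim y 0, Ext.zero_comp]

/-- Dimension shifting in degree one, for the kernel of a right approximation. -/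
theorem subsingleton_ext_one_X₁ (hS : S.ShortExact) {X : C}
    (h₂ : Subsingleton (Ext X S.X₂ 1)) (h₃ : Function.Surjective fun φ : X ⟶ S.X₂ => φ ≫ S.g) :
    Subsingleton (Ext X S.X₁ 1) :=
  subsingleton_of_forall_eq 0 fun x => by
    obtain ⟨y, rfl⟩ := Ext.covariant_sequence_exact₁ X hS x (Subsingleton.elim _ _) (zero_add 1)
    obtain ⟨φ, rfl⟩ := (Ext.mk₀_bijective X S.X₃).2 y
    obtain ⟨ψ, rfl⟩ := h₃ φ
    simp only [← Ext.mk₀_comp_mk₀]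
    rw [Ext.comp_assoc_of_second_deg_zero, hS.comp_extClass, Ext.comp_zero]

theorem subsingleton_ext_of_iso {X Y Y' : C} (e : Y ≅ Y') {k : ℕ}
    (h : Subsingleton (Ext X Y k)) : Subsingleton (Ext X Y' k) :=
  subsingleton_of_forall_eq 0 fun x => by
    have : x = (x.comp (Ext.mk₀ e.inv) (add_zero k)).comp (Ext.mk₀ e.hom) (add_zero k) := by
      simp
    rw [this, Subsingleton.elim (x.comp (Ext.mk₀ e.inv) (add_zero k)) 0, Ext.zero_comp]

end ExtVanishing

/-! ### Exact sequences remain exact under `Hom` when `Ext` vanishes -/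

section ExactSequences

open Abelian

variable {A : Type u} [Ring A]

/-- `0 → M⁰ → M¹ → ⋯ → Mⁿ⁺¹ → N → 0` is an exact sequence of modules. -/
structure IsExactSeq (n : ℕ) (M : ArrowSeq (ModuleCat.{u} A)) {N : ModuleCat.{u} A}
    (g : M.obj (n + 1) ⟶ N) : Prop where
  injective : Function.Injective (M.map 0)
  exact : ∀ i < n, Function.Exact (M.map i) (M.map (i + 1))
  exact_last : Function.Exact (M.map n) g
  surjective : Function.Surjective g

theorem comp_eq_zero_of_exact {U V W : ModuleCat.{u} A} {f : U ⟶ V} {g : V ⟶ W}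
    (h : Function.Exact f g) : f ≫ g = 0 := by
  ext x
  exact (h (f x)).2 ⟨x, rfl⟩

/-- A linear map vanishing on the kernel of a surjection factors through it. -/
theorem exists_desc_of_exact {U V W Y : ModuleCat.{u} A} {f : U ⟶ V} {g : V ⟶ W}
    (h : Function.Exact f g) (hg : Function.Surjective g) (φ : V ⟶ Y) (hφ : f ≫ φ = 0) :
    ∃ ψ : W ⟶ Y, g ≫ ψ = φ := by
  have hS : (ShortComplex.mk f g (comp_eq_zero_of_exact h)).Exact :=
    ModuleCat.shortComplex_exact _ h
  have : Epi g := (ModuleCat.epi_iff_surjective g).2 hg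
  exact ⟨hS.desc φ hφ, hS.g_desc φ hφ⟩

theorem exists_lift_of_exact {U V W X : ModuleCat.{u} A} {f : U ⟶ V} {g : V ⟶ W}
    (h : Function.Exact f g) (hf : Function.Injective f) (φ : X ⟶ V) (hφ : φ ≫ g = 0) :
    ∃ ψ : X ⟶ U, ψ ≫ f = φ := by
  have hS : (ShortComplex.mk f g (comp_eq_zero_of_exact h)).Exact :=
    ModuleCat.shortComplex_exact _ h
  have : Mono f := (ModuleCat.mono_iff_injective f).2 hf
  exact ⟨hS.lift φ hφ, hS.lift_f φ hφ⟩

/-- The image of a linear map. -/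
abbrev imageObj {V W : ModuleCat.{u} A} (f : V ⟶ W) : ModuleCat.{u} A :=
  ModuleCat.of A (LinearMap.range f.hom)

/-- The inclusion of the image. -/
abbrev imageIncl {V W : ModuleCat.{u} A} (f : V ⟶ W) : imageObj f ⟶ W :=
  ModuleCat.ofHom (LinearMap.range f.hom).subtype

/-- The projection onto the image. -/
abbrev imageProj {V W : ModuleCat.{u} A} (f : V ⟶ W) : V ⟶ imageObj f :=
  ModuleCat.ofHom f.hom.rangeRestrict

theorem imageIncl_injective {V W : ModuleCat.{u} A} (f : V ⟶ W) :
    Function.Injective (imageIncl f) := Subtype.val_injective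

theorem imageProj_surjective {V W : ModuleCat.{u} A} (f : V ⟶ W) :
    Function.Surjective (imageProj f) := LinearMap.surjective_rangeRestrict f.hom

theorem imageIncl_exact {U V W : ModuleCat.{u} A} {f : U ⟶ V} {g : V ⟶ W}
    (h : Function.Exact f g) : Function.Exact (imageIncl f) g := fun y => by
  rw [h y]
  exact ⟨fun ⟨x, hx⟩ => ⟨imageProj f x, hx⟩, fun ⟨x, hx⟩ => hx ▸ x.2⟩

theorem exact_imageProj {U V W : ModuleCat.{u} A} {f : U ⟶ V} {g : V ⟶ W}
    (h : Function.Exact f g) : Function.Exact f (imageProj g) := fun y => by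
  rw [← h y]
  exact ⟨fun hy => congrArg Subtype.val hy, fun hy => Subtype.ext hy⟩

/-- The short exact sequence `0 → Im f → V → W → 0` given by exactness at `V`. -/
theorem shortExact_imageIncl {U V W : ModuleCat.{u} A} {f : U ⟶ V} {g : V ⟶ W}
    (h : Function.Exact f g) (hg : Function.Surjective g) :
    (ShortComplex.mk (imageIncl f) g (comp_eq_zero_of_exact (imageIncl_exact h))).ShortExact :=
  ModuleCat.shortComplex_shortExact _ (imageIncl_exact h) (imageIncl_injective f) hg

/-- Induction by splitting off `0 → I → Mⁿ⁺² → N → 0` at the right end. `Ext^k(I, Y)` is squeezed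
between `Ext^k(Mⁿ⁺², Y)` and `Ext^(k+1)(N, Y)`, so each cut costs one degree, matching the drop in
length. Exactness at the cut uses `Ext^1(N, Y) = 0` to extend maps from `I`. -/
theorem homTo_exact_of_exact {Y : ModuleCat.{u} A} (M : ArrowSeq (ModuleCat.{u} A)) (n : ℕ) :
    ∀ {N : ModuleCat.{u} A} (g : M.obj (n + 1) ⟶ N),
      (∀ i < n, Function.Exact (M.map i) (M.map (i + 1))) →
      Function.Exact (M.map n) g → Function.Surjective g →
      (∀ i ≤ n + 1, ∀ k, 0 < k → k < n + 1 → Subsingleton (Ext (M.obj i) Y k)) →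
      (∀ k, 0 < k → k < n + 1 → Subsingleton (Ext N Y k)) →
      Function.Injective (fun φ : N ⟶ Y => g ≫ φ) ∧
      Function.Exact (fun φ : N ⟶ Y => g ≫ φ) (fun φ : M.obj (n + 1) ⟶ Y => M.map n ≫ φ) ∧
      (∀ i < n, Function.Exact (fun φ : M.obj (i + 2) ⟶ Y => M.map (i + 1) ≫ φ)
        (fun φ : M.obj (i + 1) ⟶ Y => M.map i ≫ φ)) := by
  induction n with
  | zero =>
    intro N g _ hlast hsurj _ _
    have : Epi g := (ModuleCat.epi_iff_surjective g).2 hsurj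
    refine ⟨fun φ ψ h => (cancel_epi g).1 h, fun φ => ⟨exists_desc_of_exact hlast hsurj φ, ?_⟩,
      fun i hi => absurd hi (Nat.not_lt_zero i)⟩
    rintro ⟨ψ, rfl⟩
    simp [← Category.assoc, comp_eq_zero_of_exact hlast]
  | succ n ih =>
    intro N g hex hlast hsurj hM hN
    have : Epi g := (ModuleCat.epi_iff_surjective g).2 hsurj
    have hS := shortExact_imageIncl hlast hsurj
    obtain ⟨-, h₁, h₂⟩ := ih (imageProj (M.map (n + 1)))
      (fun i hi => hex i (hi.trans n.lt_succ_self)) (exact_imageProj (hex n n.lt_succ_self))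
      (imageProj_surjective _) (fun i hi k hk hk' => hM i (by omega) k hk (by omega))
      (fun k hk hk' => subsingleton_ext_X₁ hS (hM (n + 2) le_rfl k hk (by omega))
        (hN (k + 1) (by omega) (by omega)))
    refine ⟨fun φ ψ h => (cancel_epi g).1 h, fun φ => ⟨exists_desc_of_exact hlast hsurj φ, ?_⟩,
      fun i hi => ?_⟩
    · rintro ⟨ψ, rfl⟩
      simp [← Category.assoc, comp_eq_zero_of_exact hlast]
    · rcases Nat.lt_succ_iff_lt_or_eq.1 hi with hi | rfl
      · exact h₂ i hi
      · intro φ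
        constructor
        · intro hφ
          obtain ⟨ψ, rfl⟩ := (h₁ φ).1 hφ
          obtain ⟨χ, rfl⟩ := exists_desc_of_subsingleton_ext hS
            (hN 1 one_pos (by omega)) ψ
          exact ⟨χ, rfl⟩
        · rintro ⟨ψ, rfl⟩
          simp [← Category.assoc, comp_eq_zero_of_exact (hex i hi)]

/-- Dimension shifting from the left end: each image is the quotient of a term by the previous
image, which costs one degree and explains the bound `k + n < d`. -/
theorem subsingleton_ext_image {X : ModuleCat.{u} A} (M : ArrowSeq (ModuleCat.{u} A)) (d n : ℕ)
    (hinj : Function.Injective (M.map 0))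
    (hex : ∀ i < n, Function.Exact (M.map i) (M.map (i + 1)))
    (hM : ∀ i ≤ n, ∀ k, 0 < k → k < d → Subsingleton (Ext X (M.obj i) k)) :
    ∀ k, 0 < k → k + n < d → Subsingleton (Ext X (imageObj (M.map n)) k) := by
  induction n with
  | zero =>
    intro k hk hkd
    exact subsingleton_ext_of_iso (LinearEquiv.ofInjective (M.map 0).hom hinj).toModuleIso
      (hM 0 le_rfl k hk hkd)
  | succ n ih =>
    intro k hk hkd
    exact subsingleton_ext_X₃ (shortExact_imageIncl (exact_imageProj (hex n n.lt_succ_self))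
        (imageProj_surjective (M.map (n + 1))))
      (hM (n + 1) le_rfl k hk (by omega))
      (ih (fun i hi => hex i (by omega)) (fun i hi => hM i (by omega)) (k + 1) (by omega)
        (by omega))

theorem homFrom_exact_of_exact {X : ModuleCat.{u} A} (M : ArrowSeq (ModuleCat.{u} A)) (d n : ℕ)
    (hn : n < d) (hinj : Function.Injective (M.map 0))
    (hex : ∀ i < n, Function.Exact (M.map i) (M.map (i + 1)))
    (hM : ∀ i ≤ n, ∀ k, 0 < k → k < d → Subsingleton (Ext X (M.obj i) k))
    {N : ModuleCat.{u} A} {g : M.obj (n + 1) ⟶ N} (hg : Function.Exact (M.map n) g) :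
    Function.Exact (fun φ : X ⟶ M.obj n => φ ≫ M.map n)
      (fun φ : X ⟶ M.obj (n + 1) => φ ≫ g) := by
  intro φ
  constructor
  · intro hφ
    cases n with
    | zero => exact exists_lift_of_exact hg hinj φ hφ
    | succ n =>
      obtain ⟨ψ, rfl⟩ := exists_lift_of_exact (imageIncl_exact hg) (imageIncl_injective _) φ hφ
      -- The obstruction to lifting from the image to `M.obj (n + 1)` lies in `Ext^1(X, Im (M.map
      -- n))`.
      obtain ⟨χ, rfl⟩ := exists_lift_of_subsingleton_ext
        (shortExact_imageIncl (exact_imageProj (hex n n.lt_succ_self))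
          (imageProj_surjective (M.map (n + 1))))
        (subsingleton_ext_image M d n hinj (fun i hi => hex i (by omega))
          (fun i hi => hM i (by omega)) 1 one_pos (by omega)) ψ
      exact ⟨χ, rfl⟩
  · rintro ⟨ψ, rfl⟩
    simp [comp_eq_zero_of_exact hg]

end ExactSequences
-- Exactness versus `d`-exactness
section DExact

open Abelian

variable {A : Type u} [Ring A] {P : ObjectProperty (ModuleCat.{u} A)}

theorem homTo_exact_of_isExactSeq {n : ℕ}
    (hP : ∀ X Y, P X → P Y → ∀ k, 0 < k → k < n + 1 → Subsingleton (Ext X Y k))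
    {M : ArrowSeq (ModuleCat.{u} A)} {N : ModuleCat.{u} A} {g : M.obj (n + 1) ⟶ N}
    (hM : ∀ i ≤ n + 1, P (M.obj i)) (hN : P N) (h : IsExactSeq n M g) :
    HomToExact P (n + 1) M g := fun _ hY =>
  homTo_exact_of_exact M n g h.exact h.exact_last h.surjective
    (fun i hi => hP _ _ (hM i hi) hY) (hP _ _ hN hY)

theorem homFrom_exact_of_isExactSeq {n : ℕ}
    (hP : ∀ X Y, P X → P Y → ∀ k, 0 < k → k < n + 1 → Subsingleton (Ext X Y k))
    {M : ArrowSeq (ModuleCat.{u} A)} {N : ModuleCat.{u} A} {g : M.obj (n + 1) ⟶ N}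
    (hM : ∀ i ≤ n + 1, P (M.obj i)) (h : IsExactSeq n M g) :
    HomFromExact P (n + 1) M g := fun X hX => by
  have : Mono (M.map 0) := (ModuleCat.mono_iff_injective _).2 h.injective
  refine ⟨fun φ ψ h => (cancel_mono (M.map 0)).1 h, fun i hi => ?_, ?_⟩
  · exact homFrom_exact_of_exact M (n + 1) i (by omega) h.injective
      (fun j hj => h.exact j (by omega)) (fun j hj => hP _ _ hX (hM j (by omega))) (h.exact i hi)
  · exact homFrom_exact_of_exact M (n + 1) n n.lt_succ_self h.injective h.exact
      (fun j hj => hP _ _ hX (hM j (by omega))) h.exact_last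

theorem isComplexIn_of_isExactSeq {n : ℕ}
    {M : ArrowSeq (ModuleCat.{u} A)} {N : ModuleCat.{u} A} {g : M.obj (n + 1) ⟶ N}
    (hM : ∀ i ≤ n + 1, P (M.obj i)) (hN : P N) (h : IsExactSeq n M g) :
    IsComplexIn P (n + 1) M g :=
  ⟨hM, hN, fun i hi => comp_eq_zero_of_exact (h.exact i (by omega)),
    comp_eq_zero_of_exact h.exact_last⟩

theorem isRightDExact_of_isExactSeq {n : ℕ}
    (hP : ∀ X Y, P X → P Y → ∀ k, 0 < k → k < n + 1 → Subsingleton (Ext X Y k))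
    {M : ArrowSeq (ModuleCat.{u} A)} {N : ModuleCat.{u} A} {g : M.obj (n + 1) ⟶ N}
    (hM : ∀ i ≤ n + 1, P (M.obj i)) (hN : P N) (h : IsExactSeq n M g) :
    IsRightDExact P (n + 1) M g :=
  ⟨isComplexIn_of_isExactSeq hM hN h, homTo_exact_of_isExactSeq hP hM hN h⟩

theorem isDExact_of_isExactSeq {n : ℕ}
    (hP : ∀ X Y, P X → P Y → ∀ k, 0 < k → k < n + 1 → Subsingleton (Ext X Y k))
    {M : ArrowSeq (ModuleCat.{u} A)} {N : ModuleCat.{u} A} {g : M.obj (n + 1) ⟶ N}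
    (hM : ∀ i ≤ n + 1, P (M.obj i)) (hN : P N) (h : IsExactSeq n M g) :
    IsDExact P (n + 1) M g :=
  ⟨⟨isComplexIn_of_isExactSeq hM hN h, homFrom_exact_of_isExactSeq hP hM h⟩,
    isRightDExact_of_isExactSeq hP hM hN h⟩

/-- The morphism from the free module of rank one that picks an element. -/
abbrev pick {V : ModuleCat.{u} A} (v : V) : ModuleCat.of A A ⟶ V :=
  ModuleCat.ofHom (LinearMap.toSpanSingleton A V v)

theorem pick_apply_one {V : ModuleCat.{u} A} (v : V) : pick v (1 : A) = v :=
  one_smul A v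

theorem pick_comp {V W : ModuleCat.{u} A} (v : V) (f : V ⟶ W) : pick v ≫ f = pick (f v) := by
  ext
  simp

theorem exact_of_homFrom_exact {U V W : ModuleCat.{u} A} {f : U ⟶ V} {g : V ⟶ W}
    (h : Function.Exact (fun φ : ModuleCat.of A A ⟶ U => φ ≫ f)
      (fun φ : ModuleCat.of A A ⟶ V => φ ≫ g)) : Function.Exact f g := by
  have hfg : ∀ x, g (f x) = 0 := fun x => by
    have : (pick x ≫ f) ≫ g = 0 := (h _).2 ⟨pick x, rfl⟩
    rw [pick_comp, pick_comp] at this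
    rw [← pick_apply_one (g (f x)), this]
    rfl
  intro v
  constructor
  · intro hv
    obtain ⟨ψ, hψ⟩ := (h (pick v)).1 (by
      change pick v ≫ g = 0
      rw [pick_comp, hv]
      ext
      simp)
    refine ⟨ψ (1 : A), ?_⟩
    have := congrArg (fun φ : ModuleCat.of A A ⟶ V => φ (1 : A)) hψ
    simpa using this
  · rintro ⟨x, rfl⟩
    exact hfg x

theorem injective_of_homFrom_injective {U V : ModuleCat.{u} A} {f : U ⟶ V}
    (h : Function.Injective (fun φ : ModuleCat.of A A ⟶ U => φ ≫ f)) : Function.Injective f := by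
  intro x y hxy
  have : pick x = pick y := h (by
    change pick x ≫ f = pick y ≫ f
    rw [pick_comp, pick_comp, hxy])
  rw [← pick_apply_one x, this, pick_apply_one]

/-- Testing left `d`-exactness on the regular module gives everything but surjectivity of `g`. For
that, the cokernel of `g` embeds in some `Y` in `P`, and the composite `N ⟶ Y` vanishes because `g`
kills it. -/
theorem isExactSeq_of_isDExact {n : ℕ} (hA : P (ModuleCat.of A A))
    (hI : ∀ W : ModuleCat.{u} A, ∀ N, P N → ∀ q : N ⟶ W, Function.Surjective q →
      ∃ Y, P Y ∧ ∃ j : W ⟶ Y, Function.Injective j)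
    {M : ArrowSeq (ModuleCat.{u} A)} {N : ModuleCat.{u} A} {g : M.obj (n + 1) ⟶ N}
    (h : IsDExact P (n + 1) M g) : IsExactSeq n M g := by
  obtain ⟨h₁, h₂, h₃⟩ := h.left.exact _ hA
  refine ⟨injective_of_homFrom_injective h₁, fun i hi => exact_of_homFrom_exact (h₂ i hi),
    exact_of_homFrom_exact h₃, ?_⟩
  let q : N ⟶ ModuleCat.of A (N ⧸ LinearMap.range g.hom) :=
    ModuleCat.ofHom (LinearMap.range g.hom).mkQ
  obtain ⟨Y, hY, j, hj⟩ := hI _ N h.left.isComplex.mem_last q (Submodule.mkQ_surjective _)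
  have h₀ : q ≫ j = 0 := (h.right.exact Y hY).1 (by
    change g ≫ q ≫ j = g ≫ 0
    have : g ≫ q = 0 := by
      ext x
      exact (Submodule.Quotient.mk_eq_zero _).2 ⟨x, rfl⟩
    rw [← Category.assoc, this, zero_comp, comp_zero])
  intro y
  have h₁ : j (q y) = j 0 := by
    rw [map_zero]
    exact congrArg (fun φ : N ⟶ Y => φ y) h₀
  exact (Submodule.Quotient.mk_eq_zero _).1 (hj h₁)

end DExact

/-! ### Comparison of complexes -/

section Lifting

variable {C : Type*} [Category C] [Preadditive C]

/-- Lifting of morphisms of complexes along left `d`-exact sequences. -/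
theorem exists_complexMorphism {P : ObjectProperty C} {M M' : ArrowSeq C} (d : ℕ) :
    ∀ {N N' : C} (g : M.obj d ⟶ N) (g' : M'.obj d ⟶ N') (v : N ⟶ N') (w : M.obj d ⟶ M'.obj d),
      (∀ i ≤ d, P (M.obj i)) → (∀ i, i + 1 < d → M.map i ≫ M.map (i + 1) = 0) →
      CompLastZero d M g → HomFromExact P d M' g' → w ≫ g' = g ≫ v →
      ∃ u : ∀ i, M.obj i ⟶ M'.obj i, u d = w ∧ ∀ i < d, M.map i ≫ u (i + 1) = u i ≫ M'.map i := by
  induction d with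
  | zero =>
    intro N N' g g' v w _ _ _ _ _
    -- Components beyond the last index play no role and are set to zero.
    exact ⟨Function.update (fun _ => 0) 0 w, by simp, fun i hi => absurd hi (Nat.not_lt_zero i)⟩
  | succ d ih =>
    intro N N' g g' v w hM hcomp hlast hex hw
    have hlast' : M.map d ≫ g = 0 := hlast
    obtain ⟨w', hw'⟩ := ((hex _ (hM d d.le_succ)).2.2 (M.map d ≫ w)).1 (by
      change (M.map d ≫ w) ≫ g' = 0
      rw [Category.assoc, hw, ← Category.assoc, hlast', zero_comp])
    -- Drop the last term: the given `w` now plays the role of `v`, and its lift `w'` that of `w`.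
    obtain ⟨u, hu, hcomm⟩ := ih (M.map d) (M'.map d) w w' (fun i hi => hM i (by omega))
      (fun i hi => hcomp i (by omega))
      (by
        cases d with
        | zero => trivial
        | succ d => exact hcomp d (by omega))
      (by
        cases d with
        | zero => exact fun X hX => (hex X hX).1
        | succ d =>
          exact fun X hX => ⟨(hex X hX).1, fun i hi => (hex X hX).2.1 i (by omega),
            (hex X hX).2.1 d (by omega)⟩)
      hw'
    refine ⟨Function.update u (d + 1) w, by simp, fun i hi => ?_⟩
    rw [Function.update_of_ne (by omega : i ≠ d + 1)]
    rcases Nat.lt_succ_iff_lt_or_eq.1 hi with hi | rfl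
    · rw [Function.update_of_ne (by omega : i + 1 ≠ d + 1)]
      exact hcomm i hi
    · rw [Function.update_self, hu]
      exact hw'.symm

end Lifting

/-! ### Exactness of the mapping cone -/

section Cone

variable {A : Type u} [Ring A]

theorem biprod_elem_ext {U V : ModuleCat.{u} A} {x y : (U ⊞ V : ModuleCat.{u} A)}
    (h₁ : (biprod.fst : U ⊞ V ⟶ U) x = (biprod.fst : U ⊞ V ⟶ U) y)
    (h₂ : (biprod.snd : U ⊞ V ⟶ V) x = (biprod.snd : U ⊞ V ⟶ V) y) : x = y := by
  have key : ∀ z : (U ⊞ V : ModuleCat.{u} A), z = (biprod.inl : U ⟶ U ⊞ V)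
      ((biprod.fst : U ⊞ V ⟶ U) z) + (biprod.inr : V ⟶ U ⊞ V) ((biprod.snd : U ⊞ V ⟶ V) z) :=
    fun z => by
      have := congrArg (fun φ : (U ⊞ V : ModuleCat.{u} A) ⟶ U ⊞ V => φ z)
        (biprod.total (X := U) (Y := V))
      exact this.symm
  rw [key x, key y, h₁, h₂]

theorem exists_biprod_elem {U V : ModuleCat.{u} A} (a : U) (b : V) :
    ∃ x : (U ⊞ V : ModuleCat.{u} A), (biprod.fst : U ⊞ V ⟶ U) x = a ∧
      (biprod.snd : U ⊞ V ⟶ V) x = b := by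
  refine ⟨(biprod.inl : U ⟶ U ⊞ V) a + (biprod.inr : V ⟶ U ⊞ V) b, ?_, ?_⟩
  · simp [← ModuleCat.comp_apply]
  · simp [← ModuleCat.comp_apply]

variable {M M' : ArrowSeq (ModuleCat.{u} A)} (u : ∀ i, M.obj i ⟶ M'.obj i)

/-- The identification of the first term of the mapping cone. -/
noncomputable def coneHead : (cone M M' u).obj 0 ⟶ M.obj 0 := 𝟙 (M.obj 0)

/-- The first projection from a term of the mapping cone. -/
noncomputable def coneFst (i : ℕ) : (cone M M' u).obj (i + 1) ⟶ M.obj (i + 1) :=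
  (biprod.fst : M.obj (i + 1) ⊞ M'.obj i ⟶ M.obj (i + 1))

/-- The second projection from a term of the mapping cone. -/
noncomputable def coneSnd (i : ℕ) : (cone M M' u).obj (i + 1) ⟶ M'.obj i :=
  (biprod.snd : M.obj (i + 1) ⊞ M'.obj i ⟶ M'.obj i)

variable {u}

theorem cone_elem_ext {i : ℕ} {x y : (cone M M' u).obj (i + 1)}
    (h₁ : coneFst u i x = coneFst u i y) (h₂ : coneSnd u i x = coneSnd u i y) : x = y :=
  biprod_elem_ext (U := M.obj (i + 1)) (V := M'.obj i) h₁ h₂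

variable (u)

theorem exists_cone_elem {i : ℕ} (a : M.obj (i + 1)) (b : M'.obj i) :
    ∃ x : (cone M M' u).obj (i + 1), coneFst u i x = a ∧ coneSnd u i x = b :=
  exists_biprod_elem a b

theorem cone_map_zero_fst (x : (cone M M' u).obj 0) :
    coneFst u 0 ((cone M M' u).map 0 x) = -M.map 0 (coneHead u x) := by
  have : (cone M M' u).map 0 ≫ coneFst u 0 = coneHead u ≫ (-M.map 0) :=
    (biprod.lift_fst _ _).trans (Category.id_comp _).symm
  exact congrArg (fun φ : (cone M M' u).obj 0 ⟶ M.obj 1 => φ x) this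

theorem cone_map_zero_snd (x : (cone M M' u).obj 0) :
    coneSnd u 0 ((cone M M' u).map 0 x) = u 0 (coneHead u x) := by
  have : (cone M M' u).map 0 ≫ coneSnd u 0 = coneHead u ≫ u 0 :=
    (biprod.lift_snd _ _).trans (Category.id_comp _).symm
  exact congrArg (fun φ : (cone M M' u).obj 0 ⟶ M'.obj 0 => φ x) this

theorem cone_map_succ_fst (i : ℕ) (x : (cone M M' u).obj (i + 1)) :
    coneFst u (i + 1) ((cone M M' u).map (i + 1) x) = -M.map (i + 1) (coneFst u i x) := by
  have : (cone M M' u).map (i + 1) ≫ coneFst u (i + 1) = coneFst u i ≫ (-M.map (i + 1)) :=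
    (Biprod.ofComponents_fst _ _ _ _).trans (by rw [comp_zero, add_zero]; rfl)
  exact congrArg (fun φ : (cone M M' u).obj (i + 1) ⟶ M.obj (i + 2) => φ x) this

theorem cone_map_succ_snd (i : ℕ) (x : (cone M M' u).obj (i + 1)) :
    coneSnd u (i + 1) ((cone M M' u).map (i + 1) x) =
      u (i + 1) (coneFst u i x) + M'.map i (coneSnd u i x) := by
  have : (cone M M' u).map (i + 1) ≫ coneSnd u (i + 1) =
      coneFst u i ≫ u (i + 1) + coneSnd u i ≫ M'.map i :=
    Biprod.ofComponents_snd _ _ _ _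
  exact congrArg (fun φ : (cone M M' u).obj (i + 1) ⟶ M'.obj (i + 1) => φ x) this

theorem coneLast_succ_apply (n : ℕ) (x : (cone M M' u).obj (n + 1)) :
    coneLast M M' u (n + 1) x = u (n + 1) (coneFst u n x) + M'.map n (coneSnd u n x) := by
  have : coneLast M M' u (n + 1) = coneFst u n ≫ u (n + 1) + coneSnd u n ≫ M'.map n :=
    biprod.desc_eq
  exact congrArg (fun φ : (cone M M' u).obj (n + 1) ⟶ M'.obj (n + 1) => φ x) this

/-- If `z = (a, b)` is a cycle and `a` is the image of `x`, then `u x + b` is a cycle of `M'`. For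
`i > 0` it is the image of some `y`, and `(-x, y)` maps to `z`; for `i = 0` it is zero by
injectivity and `-x` suffices. The cycle condition `hz` has the same form for inner differentials
and for `coneLast`, so both cases are served. -/
theorem mem_range_cone_map {i : ℕ} (hinj : Function.Injective (M'.map 0))
    (hex : ∀ j < i, Function.Exact (M'.map j) (M'.map (j + 1)))
    (hcomm : M.map i ≫ u (i + 1) = u i ≫ M'.map i) {x : M.obj i}
    {z : (cone M M' u).obj (i + 1)} (hx : M.map i x = coneFst u i z)
    (hz : u (i + 1) (coneFst u i z) + M'.map i (coneSnd u i z) = 0) :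
    ∃ y, (cone M M' u).map i y = z := by
  have hc : M'.map i (u i x) = u (i + 1) (M.map i x) :=
    (congrArg (fun φ : M.obj i ⟶ M'.obj (i + 1) => φ x) hcomm).symm
  have h₀ : M'.map i (u i x + coneSnd u i z) = 0 := by
    rw [map_add, hc, hx]
    exact hz
  cases i with
  | zero =>
    obtain ⟨y, hy⟩ : ∃ y, coneHead u y = -x := ⟨(-x : M.obj 0), rfl⟩
    refine ⟨y, cone_elem_ext ?_ ?_⟩
    · rw [cone_map_zero_fst, hy, map_neg, neg_neg, hx]
    · rw [cone_map_zero_snd, hy, map_neg]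
      exact neg_eq_of_add_eq_zero_right (hinj (h₀.trans (map_zero _).symm))
  | succ i =>
    obtain ⟨y, hy⟩ := (hex i i.lt_succ_self _).1 h₀
    obtain ⟨t, ht₁, ht₂⟩ := exists_cone_elem u (-x) y
    refine ⟨t, cone_elem_ext ?_ ?_⟩
    · rw [cone_map_succ_fst, ht₁, map_neg, neg_neg, hx]
    · rw [cone_map_succ_snd, ht₁, ht₂, hy, map_neg]
      abel

theorem cone_map_comp_zero {i : ℕ}
    (hex' : ∀ j < i, Function.Exact (M'.map j) (M'.map (j + 1)))
    (hcomm : M.map i ≫ u (i + 1) = u i ≫ M'.map i) (y : (cone M M' u).obj i) :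
    u (i + 1) (coneFst u i ((cone M M' u).map i y)) +
      M'.map i (coneSnd u i ((cone M M' u).map i y)) = 0 := by
  have hc : ∀ x, u (i + 1) (M.map i x) = M'.map i (u i x) := fun x =>
    congrArg (fun φ : M.obj i ⟶ M'.obj (i + 1) => φ x) hcomm
  cases i with
  | zero => rw [cone_map_zero_fst, cone_map_zero_snd, map_neg, hc, neg_add_cancel]
  | succ i =>
    rw [cone_map_succ_fst, cone_map_succ_snd, map_neg, hc, map_add,
      (hex' i i.lt_succ_self).apply_apply_eq_zero, add_zero, neg_add_cancel]

theorem exists_cone_map_fst {i : ℕ} (y : (cone M M' u).obj i) :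
    ∃ x, coneFst u i ((cone M M' u).map i y) = M.map i x := by
  cases i with
  | zero => exact ⟨-coneHead u y, by rw [cone_map_zero_fst, map_neg]⟩
  | succ i => exact ⟨-coneFst u i y, by rw [cone_map_succ_fst, map_neg]⟩

/-- The mapping cone of a morphism between exact sequences with the same last term, the last
terms being omitted. -/
theorem isExactSeq_cone {n : ℕ} {N : ModuleCat.{u} A} {g : M.obj (n + 1) ⟶ N}
    {g' : M'.obj (n + 1) ⟶ N} (h : IsExactSeq n M g) (h' : IsExactSeq n M' g')
    (hcomm : ∀ i < n + 1, M.map i ≫ u (i + 1) = u i ≫ M'.map i) (hlast : u (n + 1) ≫ g' = g) :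
    IsExactSeq n (cone M M' u) (coneLast M M' u (n + 1)) := by
  have hl : ∀ x, g' (u (n + 1) x) = g x := fun x =>
    congrArg (fun φ : M.obj (n + 1) ⟶ N => φ x) hlast
  refine ⟨fun x y hxy => ?_, fun i hi z => ⟨fun hz => ?_, ?_⟩, fun z => ⟨fun hz => ?_, ?_⟩,
    fun y => ?_⟩
  · have h₁ := congrArg (coneFst u 0) hxy
    rw [cone_map_zero_fst, cone_map_zero_fst] at h₁
    exact h.injective (neg_injective h₁)
  · have h₁ := cone_map_succ_fst u i z
    have h₂ := cone_map_succ_snd u i z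
    rw [hz, map_zero] at h₁ h₂
    obtain ⟨x, hx⟩ := (h.exact i hi _).1 (neg_eq_zero.1 h₁.symm)
    exact mem_range_cone_map u h'.injective (fun j hj => h'.exact j (by omega))
      (hcomm i (by omega)) hx h₂.symm
  · rintro ⟨y, rfl⟩
    refine cone_elem_ext ?_ ?_
    · obtain ⟨x, hx⟩ := exists_cone_map_fst u y
      rw [cone_map_succ_fst, hx, (h.exact i hi).apply_apply_eq_zero, neg_zero, map_zero]
    · rw [cone_map_succ_snd, cone_map_comp_zero u (fun j hj => h'.exact j (by omega))
        (hcomm i (by omega)), map_zero]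
  · rw [coneLast_succ_apply] at hz
    -- Applying `g'` kills the summand from `M'` and turns `u (n + 1)` into `g`; this is where the
    -- common last term `N` enters.
    have h₁ := congrArg g' hz
    rw [map_add, hl, h'.exact_last.apply_apply_eq_zero, add_zero, map_zero] at h₁
    obtain ⟨x, hx⟩ := (h.exact_last _).1 h₁
    exact mem_range_cone_map u h'.injective h'.exact (hcomm n n.lt_succ_self) hx hz
  · rintro ⟨y, rfl⟩
    rw [coneLast_succ_apply]
    exact cone_map_comp_zero u h'.exact (hcomm n n.lt_succ_self) y
  · obtain ⟨m, hm⟩ := h.surjective (g' y)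
    obtain ⟨b, hb⟩ := (h'.exact_last (y - u (n + 1) m)).1 (by rw [map_sub, hl, hm, sub_self])
    obtain ⟨t, ht₁, ht₂⟩ := exists_cone_elem u m b
    refine ⟨t, ?_⟩
    rw [coneLast_succ_apply, ht₁, ht₂, hb]
    abel

end Cone
-- Turning resolutions into ascending sequences
section Reverse

variable {C : Type*} [Category C] [HasZeroMorphisms C] (Z : ℕ → C) (δ : ∀ j, Z (j + 1) ⟶ Z j)

/-- The morphisms of a descending sequence, indexed by source and target. -/
def revMap (a b : ℕ) : Z a ⟶ Z b :=
  -- In `reverseSeq`, the indices `m - i` and `m - (i + 1)` are consecutive only propositionally,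
  -- and only for `i < m`; the zero default is met beyond that range.
  if h : a = b + 1 then eqToHom (congrArg Z h) ≫ δ b else 0

/-- The ascending sequence `Zᵐ ⟶ Zᵐ⁻¹ ⟶ ⋯ ⟶ Z⁰` obtained from a descending one. -/
def reverseSeq (m : ℕ) : ArrowSeq C where
  obj i := Z (m - i)
  map i := revMap Z δ (m - i) (m - (i + 1))

theorem revMap_succ (b : ℕ) : revMap Z δ (b + 1) b = δ b := by
  simp [revMap]

end Reverse

section ReverseExact

variable {A : Type u} [Ring A] {Z : ℕ → ModuleCat.{u} A} {δ : ∀ j, Z (j + 1) ⟶ Z j}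

theorem revMap_exact {a b c : ℕ} (hab : a = b + 1) (hbc : b = c + 1)
    (h : Function.Exact (δ (c + 1)) (δ c)) :
    Function.Exact (revMap Z δ a b) (revMap Z δ b c) := by
  subst hab hbc
  rwa [revMap_succ, revMap_succ]

theorem revMap_exact_last {N : ModuleCat.{u} A} {p : Z 0 ⟶ N} {a b : ℕ} (hab : a = b + 1)
    (hb : b = 0) (h : Function.Exact (δ 0) p) :
    Function.Exact (revMap Z δ a b) (eqToHom (congrArg Z hb) ≫ p) := by
  subst hab hb
  rwa [revMap_succ, eqToHom_refl, Category.id_comp]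

theorem revMap_injective {a b : ℕ} (hab : a = b + 1) (h : Function.Injective (δ b)) :
    Function.Injective (revMap Z δ a b) := by
  subst hab
  rwa [revMap_succ]

theorem eqToHom_comp_surjective {N : ModuleCat.{u} A} {p : Z 0 ⟶ N} {b : ℕ} (hb : b = 0)
    (h : Function.Surjective p) : Function.Surjective (eqToHom (congrArg Z hb) ≫ p) := by
  subst hb
  rwa [eqToHom_refl, Category.id_comp]

theorem isExactSeq_reverseSeq {n : ℕ} {N : ModuleCat.{u} A} {p : Z 0 ⟶ N}
    (hinj : Function.Injective (δ n))
    (hex : ∀ j < n, Function.Exact (δ (j + 1)) (δ j)) (hlast : Function.Exact (δ 0) p)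
    (hsurj : Function.Surjective p) :
    IsExactSeq n (reverseSeq Z δ (n + 1))
      ((eqToIso (congrArg Z (Nat.sub_self (n + 1)))).hom ≫ p) where
  injective := revMap_injective (by omega) hinj
  exact i hi := revMap_exact (by omega) (by omega) (hex _ (by omega))
  exact_last := revMap_exact_last (by omega) (Nat.sub_self _) hlast
  surjective := eqToHom_comp_surjective (Nat.sub_self _) hsurj

/-- A morphism of modules, to be thought of as one step of a resolution. -/
structure Cover (A : Type u) [Ring A] where
  base : ModuleCat.{u} A
  top : ModuleCat.{u} A
  proj : top ⟶ base

/-- The kernel of a cover. -/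
abbrev Cover.ker (s : Cover A) : ModuleCat.{u} A := ModuleCat.of A (LinearMap.ker s.proj.hom)

/-- The inclusion of the kernel of a cover. -/
abbrev Cover.incl (s : Cover A) : s.ker ⟶ s.top :=
  ModuleCat.ofHom (LinearMap.ker s.proj.hom).subtype

theorem Cover.exact_incl (s : Cover A) : Function.Exact s.incl s.proj :=
  LinearMap.exact_subtype_ker_map s.proj.hom

theorem Cover.shortExact (s : Cover A) (h : Function.Surjective s.proj) :
    (ShortComplex.mk s.incl s.proj (comp_eq_zero_of_exact s.exact_incl)).ShortExact :=
  ModuleCat.shortComplex_shortExact _ s.exact_incl Subtype.val_injective h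

theorem exact_comp_of_surjective {T U V W : ModuleCat.{u} A} {q : T ⟶ U} {f : U ⟶ V} {g : V ⟶ W}
    (hq : Function.Surjective q) (h : Function.Exact f g) : Function.Exact (q ≫ f) g := fun y => by
  rw [h y]
  constructor
  · rintro ⟨x, rfl⟩
    obtain ⟨t, rfl⟩ := hq x
    exact ⟨t, rfl⟩
  · rintro ⟨t, rfl⟩
    exact ⟨q t, rfl⟩

theorem exact_comp_of_injective {T U V W : ModuleCat.{u} A} {f : T ⟶ U} {g : U ⟶ V} {j : V ⟶ W}
    (hj : Function.Injective j) (h : Function.Exact f g) : Function.Exact f (g ≫ j) := fun y => by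
  rw [← h y]
  exact ⟨fun hy => hj (hy.trans (map_zero j.hom).symm), fun hy => by
    rw [ModuleCat.comp_apply, hy, map_zero]⟩

end ReverseExact

/-! ### Cluster-tilting subcategories and resolutions by approximations -/

section ClusterTilting

open Abelian

variable {Λ : Type u} [Ring Λ] {P : ObjectProperty (ModuleCat.{u} Λᵐᵒᵖ)} {d : ℕ}

theorem finLength_iff_finite [IsArtinianRing Λᵐᵒᵖ] (V : ModuleCat.{u} Λᵐᵒᵖ) :
    finLength Λ V ↔ Module.Finite Λᵐᵒᵖ V :=
  (IsArtinianRing.tfae Λᵐᵒᵖ V).out 3 0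

namespace IsClusterTilting

variable (hP : IsClusterTilting d P)
include hP

theorem finLength_of_mem {V : ModuleCat.{u} Λᵐᵒᵖ} (hV : P V) : finLength Λ V :=
  ((hP.mem_iff_ext_to V).1 hV).1

theorem subsingleton_ext (X Y : ModuleCat.{u} Λᵐᵒᵖ) (hX : P X) (hY : P Y) (k : ℕ) (hk : 0 < k)
    (hkd : k < d) : Subsingleton (Ext X Y k) :=
  ((hP.mem_iff_ext_to X).1 hX).2 Y hY k hk hkd

theorem mem_of_projective {V : ModuleCat.{u} Λᵐᵒᵖ} [Projective V] (hV : finLength Λ V) : P V :=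
  (hP.mem_iff_ext_to V).2 ⟨hV, fun Y _ k hk _ => by
    obtain ⟨k, rfl⟩ := Nat.exists_eq_add_of_lt hk
    rw [zero_add]
    exact Ext.subsingleton_of_projective V Y k⟩

theorem mem_of_injective {V : ModuleCat.{u} Λᵐᵒᵖ} [Injective V] (hV : finLength Λ V) : P V :=
  (hP.mem_iff_ext_from V).2 ⟨hV, fun Y _ k hk _ => by
    obtain ⟨k, rfl⟩ := Nat.exists_eq_add_of_lt hk
    rw [zero_add]
    exact Ext.subsingleton_of_injective Y V k⟩

theorem regular_mem [IsArtinianRing Λᵐᵒᵖ] : P (ModuleCat.of Λᵐᵒᵖ Λᵐᵒᵖ) := by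
  have : Projective (ModuleCat.of Λᵐᵒᵖ Λᵐᵒᵖ) :=
    (IsProjective.iff_projective (R := Λᵐᵒᵖ) Λᵐᵒᵖ).1 inferInstance
  exact hP.mem_of_projective ((finLength_iff_finite _).2 (Module.Finite.self Λᵐᵒᵖ))

theorem biprod_mem [IsArtinianRing Λᵐᵒᵖ] {U V : ModuleCat.{u} Λᵐᵒᵖ} (hU : P U) (hV : P V) :
    P (U ⊞ V) := by
  have hS : (ShortComplex.mk (biprod.inl : U ⟶ U ⊞ V) biprod.snd biprod.inl_snd).ShortExact :=
    (ShortComplex.Splitting.ofHasBinaryBiproduct U V).shortExact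
  refine (hP.mem_iff_ext_to _).2 ⟨?_, fun Y hY k hk hkd => subsingleton_ext_X₂ hS
    (hP.subsingleton_ext _ _ hU hY k hk hkd) (hP.subsingleton_ext _ _ hV hY k hk hkd)⟩
  have hU' := (finLength_iff_finite _).1 (hP.finLength_of_mem hU)
  have hV' := (finLength_iff_finite _).1 (hP.finLength_of_mem hV)
  exact (finLength_iff_finite _).2
    (Module.Finite.equiv (ModuleCat.biprodIsoProd U V).toLinearEquiv.symm)

theorem exists_injective_embedding {R : Type u} [CommRing R] [IsArtinianRing R] [Algebra R Λᵐᵒᵖ]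
    [Module.Finite R Λᵐᵒᵖ] [IsArtinianRing Λᵐᵒᵖ] {W : ModuleCat.{u} Λᵐᵒᵖ} (hW : finLength Λ W) :
    ∃ Y, P Y ∧ ∃ j : W ⟶ Y, Function.Injective j := by
  have := (finLength_iff_finite _).1 hW
  obtain ⟨E, _, _, ι, hE, hfin, hι⟩ := exists_finite_injective_embedding_of_algebra R Λᵐᵒᵖ W
  have : Injective (ModuleCat.of Λᵐᵒᵖ E) := (Module.injective_iff_injective_object Λᵐᵒᵖ E).1 hE
  exact ⟨ModuleCat.of Λᵐᵒᵖ E, hP.mem_of_injective ((finLength_iff_finite _).2 hfin),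
    ModuleCat.ofHom ι, hι⟩

theorem surjective_of_approximation [IsArtinianRing Λᵐᵒᵖ] {Z K : ModuleCat.{u} Λᵐᵒᵖ} {p : Z ⟶ K}
    (hp : ∀ X', P X' → Function.Surjective (fun φ : X' ⟶ Z => φ ≫ p)) :
    Function.Surjective p := by
  intro v
  obtain ⟨φ, hφ⟩ := hp _ hP.regular_mem (pick v)
  refine ⟨φ (1 : Λᵐᵒᵖ), ?_⟩
  have := congrArg (fun ψ : ModuleCat.of Λᵐᵒᵖ Λᵐᵒᵖ ⟶ K => ψ (1 : Λᵐᵒᵖ)) hφ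
  exact this.trans (pick_apply_one v)

/-- Right approximations that are isomorphisms whenever possible. -/
theorem exists_approximation (K : ModuleCat.{u} Λᵐᵒᵖ) :
    ∃ s : Σ Z : ModuleCat.{u} Λᵐᵒᵖ, (Z ⟶ K), finLength Λ K → P s.1 ∧
      (∀ X', P X' → Function.Surjective (fun φ : X' ⟶ s.1 => φ ≫ s.2)) ∧
      (P K → Function.Injective s.2) := by
  -- Choosing the identity when `K` is already in `P` is what lets a resolution stop there. Modules
  -- not of finite length get a dummy value, so that the choice is total and can be iterated.
  by_cases hK : P K
  · exact ⟨⟨K, 𝟙 K⟩, fun _ => ⟨hK, fun X' _ φ => ⟨φ, Category.comp_id φ⟩,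
      fun _ => Function.injective_id⟩⟩
  · by_cases hf : finLength Λ K
    · obtain ⟨Z, hZ, p, hp⟩ := hP.contravariantlyFinite K hf
      exact ⟨⟨Z, p⟩, fun _ => ⟨hZ, hp, fun h => absurd h hK⟩⟩
    · exact ⟨⟨K, 𝟙 K⟩, fun h => absurd h hf⟩

end IsClusterTilting

/-- A surjection in a `(n+1)`-cluster-tilting subcategory is the last morphism of an exact
sequence. -/
theorem IsClusterTilting.exists_isExactSeq [IsArtinianRing Λᵐᵒᵖ] {n : ℕ}
    (hP : IsClusterTilting (n + 1) P) {Y N : ModuleCat.{u} Λᵐᵒᵖ} (hY : P Y) (p : Y ⟶ N)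
    (hp : Function.Surjective p) :
    ∃ (M : ArrowSeq (ModuleCat.{u} Λᵐᵒᵖ)) (e : M.obj (n + 1) ≅ Y),
      IsExactSeq n M (e.hom ≫ p) ∧ ∀ i ≤ n + 1, P (M.obj i) := by
  choose ap hap using hP.exists_approximation
  -- Start from `p` and repeatedly approximate the kernel of the previous cover.
  let s : ℕ → Cover Λᵐᵒᵖ := fun j =>
    Nat.rec ⟨N, Y, p⟩ (fun _ t => ⟨t.ker, (ap t.ker).1, (ap t.ker).2⟩) j
  let ι : ∀ j, (s (j + 1)).base ⟶ (s j).top := fun j => (s j).incl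
  have hfin : ∀ j, P (s j).top ∧ finLength Λ (s (j + 1)).base := by
    intro j
    induction j with
    | zero =>
      exact ⟨hY, (hP.finLength_of_mem hY).of_injective (f := (s 0).incl.hom)
        Subtype.val_injective⟩
    | succ j ih =>
      have h := (hap (s j).ker ih.2).1
      exact ⟨h, (hP.finLength_of_mem h).of_injective (f := (s (j + 1)).incl.hom)
        Subtype.val_injective⟩
  have happ : ∀ j, ∀ X', P X' →
      Function.Surjective (fun φ : X' ⟶ (s (j + 1)).top => φ ≫ (s (j + 1)).proj) := fun j =>
    (hap (s j).ker (hfin j).2).2.1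
  have hsurj : ∀ j, Function.Surjective (s j).proj := by
    intro j
    cases j with
    | zero => exact hp
    | succ j => exact hP.surjective_of_approximation (happ j)
  -- Each kernel gains one degree of vanishing: degree one because the cover is an approximation,
  -- higher degrees by shifting from the previous kernel. At `j = n` this is the criterion for
  -- membership in `P`, so the next cover is an isomorphism and the sequence ends.
  have hext : ∀ j ≤ n, ∀ X', P X' → ∀ k, 0 < k → k < j + 1 →
      Subsingleton (Ext X' (s (j + 1)).base k) := by
    intro j
    induction j with
    | zero => exact fun _ X' _ k hk hk' => absurd hk' (by omega)
    | succ j ih =>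
      intro hj X' hX' k hk hk'
      have hS := (s (j + 1)).shortExact (hsurj (j + 1))
      have h₂ := hP.subsingleton_ext X' _ hX' (hfin (j + 1)).1 k hk (by omega)
      obtain _ | _ | k := k
      · exact absurd hk (lt_irrefl 0)
      · exact subsingleton_ext_one_X₁ hS h₂ (happ j X' hX')
      · exact subsingleton_ext_succ_X₁ hS h₂ (ih (by omega) X' hX' (k + 1) (by omega) (by omega))
  have hmem : P (s (n + 1)).base :=
    (hP.mem_iff_ext_from _).2 ⟨(hfin n).2, hext n le_rfl⟩
  let δ : ∀ j, (s (j + 1)).top ⟶ (s j).top := fun j => (s (j + 1)).proj ≫ ι j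
  have hιinj : ∀ j, Function.Injective (ι j) := fun j => Subtype.val_injective
  refine ⟨reverseSeq (fun j => (s j).top) δ (n + 1), _,
    isExactSeq_reverseSeq ?_ (fun j _ => ?_) ?_ hp, fun i _ => (hfin _).1⟩
  · have h := (hap (s n).ker (hfin n).2).2.2 hmem
    exact (hιinj n).comp h
  · exact exact_comp_of_injective (hιinj j)
      (exact_comp_of_surjective (hsurj (j + 2)) (s (j + 1)).exact_incl)
  · exact exact_comp_of_surjective (hsurj 1) (s 0).exact_incl

end ClusterTilting

end HigherAR

/-! ### Proof of the proposition -/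

theorem mainTheorem7
    (R Λ : Type u) [CommRing R] [IsArtinianRing R] [Ring Λ] [Algebra R Λ] [Module.Finite R Λ]
    (d : ℕ) (hd : 0 < d)
    (P : ObjectProperty (ModuleCat.{u} Λᵐᵒᵖ)) (hP : HigherAR.IsClusterTilting d P)
    (X : ModuleCat.{u} Λᵐᵒᵖ) (hX : P X)
    (M : HigherAR.ArrowSeq (ModuleCat.{u} Λᵐᵒᵖ)) (N : ModuleCat.{u} Λᵐᵒᵖ) (g : M.obj d ⟶ N)
    (hδ : HigherAR.IsDExact P d M g) :
    ∃ (MX : HigherAR.ArrowSeq (ModuleCat.{u} Λᵐᵒᵖ)) (gX : MX.obj d ⟶ N)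
      (φ : ∀ i, M.obj i ⟶ MX.obj i),
      HigherAR.IsDExact P d MX gX ∧
      HigherAR.IsDPushout P d M MX φ ∧
      φ d ≫ gX = g ∧
      HigherAR.IsRightDetermined P X gX ∧
      HigherAR.imHom X gX = HigherAR.imHom X g := by
  open HigherAR in
  obtain ⟨n, rfl⟩ : ∃ n, d = n + 1 := ⟨d - 1, by omega⟩
  have : Module.Finite R Λᵐᵒᵖ := Module.Finite.equiv (MulOpposite.opLinearEquiv R)
  have : IsArtinianRing Λᵐᵒᵖ := IsArtinianRing.of_finite R Λᵐᵒᵖ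
  have hM := hδ.left.isComplex.mem
  have hN := hδ.left.isComplex.mem_last
  have hseq : IsExactSeq n M g := isExactSeq_of_isDExact hP.regular_mem
    (fun W N' hN' q hq => hP.exists_injective_embedding (R := R)
      ((hP.finLength_of_mem hN').of_surjective (f := q.hom) hq)) hδ
  have hXfin := (finLength_iff_finite _).1 (hP.finLength_of_mem hX)
  have hNfin := (finLength_iff_finite _).1 (hP.finLength_of_mem hN)
  let _ : Module R N := Module.compHom N (algebraMap R Λᵐᵒᵖ)
  have : IsScalarTower R Λᵐᵒᵖ N := IsScalarTower.of_algebraMap_smul fun _ _ => rfl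
  let _ : Module R (M.obj (n + 1)) := Module.compHom (M.obj (n + 1)) (algebraMap R Λᵐᵒᵖ)
  have : IsScalarTower R Λᵐᵒᵖ (M.obj (n + 1)) :=
    IsScalarTower.of_algebraMap_smul fun _ _ => rfl
  let H : Submodule R (X →ₗ[Λᵐᵒᵖ] N) :=
    { carrier := Set.range fun f : X →ₗ[Λᵐᵒᵖ] M.obj (n + 1) => g.hom ∘ₗ f
      add_mem' := by
        rintro _ _ ⟨f, rfl⟩ ⟨f', rfl⟩
        exact ⟨f + f', LinearMap.comp_add _ _ _⟩
      zero_mem' := ⟨0, LinearMap.comp_zero _⟩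
      smul_mem' := by
        rintro r _ ⟨f, rfl⟩
        exact ⟨r • f, LinearMap.ext fun x => (g.hom.restrictScalars R).map_smul r (f x)⟩ }
  obtain ⟨K, _, _, π, hK, hK₁, hK₂⟩ := exists_universal_over H
  obtain ⟨Y, hY, p, hp⟩ := hP.contravariantlyFinite (ModuleCat.of Λᵐᵒᵖ K)
    ((finLength_iff_finite _).2 hK)
  -- Universality of `K` followed by approximation. Applied to `g` it yields `w`, hence surjectivity
  -- of `g_X`; applied to a general `h` it yields right determination.
  have hfactor : ∀ (V : ModuleCat.{u} Λᵐᵒᵖ), P V → ∀ h : V ⟶ N,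
      (∀ f : X ⟶ V, f ≫ h ∈ imHom X g) → ∃ w : V ⟶ Y, w ≫ p ≫ ModuleCat.ofHom π = h := by
    intro V hV h hh
    obtain ⟨k, hk⟩ := hK₂ V h.hom fun f => by
      obtain ⟨ψ, hψ⟩ := hh (ModuleCat.ofHom f)
      exact ⟨ψ.hom, congrArg ModuleCat.Hom.hom hψ⟩
    obtain ⟨w, hw⟩ := hp V hV (ModuleCat.ofHom k)
    refine ⟨w, ?_⟩
    change w ≫ p = _ at hw
    rw [← Category.assoc, hw]
    exact ModuleCat.hom_ext hk
  obtain ⟨w, hw⟩ := hfactor _ (hM _ le_rfl) g fun f => ⟨f, rfl⟩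
  have hgX : Function.Surjective (p ≫ ModuleCat.ofHom π) := fun y => by
    obtain ⟨x, rfl⟩ := hseq.surjective y
    exact ⟨w x, congrArg (fun ψ : M.obj (n + 1) ⟶ N => ψ x) hw⟩
  obtain ⟨MX, e, hMX, hMXmem⟩ := hP.exists_isExactSeq hY _ hgX
  have hdex := isDExact_of_isExactSeq hP.subsingleton_ext hMXmem hN hMX
  have hcomp : (w ≫ e.inv) ≫ e.hom ≫ p ≫ ModuleCat.ofHom π = g := by simpa using hw
  obtain ⟨φ, hφ, hcomm⟩ := exists_complexMorphism (n + 1) g (e.hom ≫ p ≫ ModuleCat.ofHom π) (𝟙 N)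
    (w ≫ e.inv) hM hδ.left.isComplex.comp_zero hδ.left.isComplex.comp_last hdex.left.exact
    (by rw [hcomp, Category.comp_id])
  have hφg : φ (n + 1) ≫ e.hom ≫ p ≫ ModuleCat.ofHom π = g := by rw [hφ, hcomp]
  -- Every map from `X` through `K` lands in `H`; the reverse inclusion comes from `g` factoring
  -- through `g_X`.
  have him : imHom X (e.hom ≫ p ≫ ModuleCat.ofHom π) ⊆ imHom X g := by
    rintro _ ⟨ψ, rfl⟩
    obtain ⟨f, hf⟩ := hK₁ (ψ ≫ e.hom ≫ p).hom
    exact ⟨ModuleCat.ofHom f, ModuleCat.hom_ext hf⟩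
  refine ⟨MX, e.hom ≫ p ≫ ModuleCat.ofHom π, φ, hdex, ⟨⟨hδ.left.isComplex.comp_zero,
    hdex.left.isComplex.comp_zero, hcomm⟩, isRightDExact_of_isExactSeq hP.subsingleton_ext ?_
      (hMXmem _ le_rfl) (isExactSeq_cone φ hseq hMX hcomm hφg)⟩, hφg, ?_, ?_⟩
  · intro i hi
    cases i with
    | zero => exact hM 0 (Nat.zero_le _)
    | succ i => exact hP.biprod_mem (hM _ hi) (hMXmem i (by omega))
  · intro V hV h hh
    obtain ⟨v, hv⟩ := hfactor V hV h fun f => him (hh ⟨f, rfl⟩)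
    exact ⟨v ≫ e.inv, by simpa using hv⟩
  · refine Set.Subset.antisymm him ?_
    rintro _ ⟨ψ, rfl⟩
    exact ⟨ψ ≫ φ (n + 1), by simp only [Category.assoc, hφg]⟩
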